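/- Let $\beta\in[0,1]$, $\rho\in(-1,1)$, $\bar\rho=\sqrt{1-\rho^2}$, and for $j\in\{0,1\}$ put $$\widetilde m_j(x,y)=\frac{1}{\bar\rho\,|x|^{\beta(1+j)}},\qquad \widetilde{\mathcal H}_j=L^2(\mathbb R^2,\widetilde m_j\,dx\,dy).$$ Consider $$\widetilde\Gamma(f_1,f_2)=|x|^{2\beta}\,\partial_xf_1\,\partial_xf_2+\rho|x|^{\beta}\left(\partial_xf_1\,\partial_yf_2+\partial_yf_1\,\partial_xf_2\right)+\partial_yf_1\,\partial_yf_2,$$ $$\widetilde{\mathcal E}_j(f_1,f_2)=\frac12\int_{\mathbb R^2}\widetilde\Gamma(f_1,f_2)\,\widetilde m_j\,dx\,dy .$$ A symmetric form on a real Hilbert space is a non-negative definite symmetric bilinear form $\mathcal E$ on a dense linear subspace $D(\mathcal E)$. It is closed if $D(\mathcal E)$ is complete for the norm $(\mathcal E(f,f)+\|f\|^2)^{1/2}$, and closable if it has a closed extension. A closed form on an $L^2$-space is a Dirichlet form if $u\in D(\mathcal E)$ implies $u^+\wedge1\in D(\mathcal E)$ and $\mathcal E(u^+\wedge1,u^+\wedge1)\le\mathcal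 E(u,u)$. The generator $\Phi(\mathcal E)$ has as its domain the set of $u\in D(\mathcal E)$ for which there is a vector $w$ with $\mathcal E(u,v)=-(w,v)$ for all $v\in D(\mathcal E)$; then $\Phi(\mathcal E)u=w$. Here $C_0^\infty(U)$ denotes the smooth functions with compact support in the open set $U$. Let $D(\widetilde{\mathcal E}_j)$ be the set of all $u\in\widetilde{\mathcal H}_j$ such that for almost every $\bar y$ the function $x\mapsto u(x,\bar y)$, and for almost every $\bar x$ the function $y\mapsto u(\bar x,y)$, has a (locally) absolutely continuous version on $\mathbb R$, and such that $\widetilde\Gamma(u,u)\in L^1(\mathbb R^2,\widetilde m_j\,dx\,dy)$, where $\partial_xu,\partial_yu$ are the derivatives of these versions. On functions of $C_0^\infty(\mathbb R^2)$ these are the classical partial derivatives. Suppose that $j=0$ and $\beta\in[0,1)$, or that $j=1$ and $\beta\in[0,\tfrac12)$. Then: (i) $(\widetilde{\mathcal E}_j,C_0^\infty(\mathbb R^2))$ is a symmetric form on $\widetilde{\mathcal H}_j$, and it is closable. (ii) $(\widetilde{\mathcal E}_j,D(\widetilde{\mathcal E}_j))$ is a Dirichlet form on $\widetilde{\mathcal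 H}_j$. Moreover, let $\mathcal S=(0,\infty)^2$ and $$\widetilde Af=\tfrac12\left(x^{2\beta}\partial_{xx}f+2\rho x^\beta\partial_{xy}f+\partial_{yy}f\right),\qquad \widetilde\Delta_gf=\tfrac{\beta}{2}x^{2\beta-1}\partial_xf+\widetilde Af .$$ Then for all $\beta\in[0,1]$, with $\Phi(\widetilde{\mathcal E}_j)$ the generator of $(\widetilde{\mathcal E}_j,D(\widetilde{\mathcal E}_j))$ as defined above: (iii) every $f_1\in C_0^\infty(\mathcal S)$ lies in the domain of $\Phi(\widetilde{\mathcal E}_0)$, $\Phi(\widetilde{\mathcal E}_0)f_1=\widetilde\Delta_gf_1$, and for all $f_1,f_2\in C_0^\infty(\mathcal S)$ $$(\Phi(\widetilde{\mathcal E}_0)f_1,f_2)_{\widetilde{\mathcal H}_0}=(\widetilde\Delta_gf_1,f_2)_{\widetilde{\mathcal H}_0}=-\widetilde{\mathcal E}_0(f_1,f_2);$$ if $\beta=0$, the same holds with $\widetilde A$ in place of $\widetilde\Delta_g$. (iv) If $\rho=0$, every $f_1\in C_0^\infty(\mathcal S)$ lies in the domain of $\Phi(\widetilde{\mathcal E}_1)$,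 $\Phi(\widetilde{\mathcal E}_1)f_1=\widetilde Af_1$, and for all $f_1,f_2\in C_0^\infty(\mathcal S)$ $$(\Phi(\widetilde{\mathcal E}_1)f_1,f_2)_{\widetilde{\mathcal H}_1}=(\widetilde Af_1,f_2)_{\widetilde{\mathcal H}_1}=-\widetilde{\mathcal E}_1(f_1,f_2).$$ -/

import Mathlib

open MeasureTheory Filter Topology

noncomputable section

namespace TimeChangedSABR

/-! ### Closed forms, Dirichlet forms and generators

A form on a real Hilbert space `H` is given by its values `E : H → H → ℝ` together with its domain
`D : Set H`; only the values of `E` on `D × D` matter. -/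

section Forms

variable {H : Type*} [NormedAddCommGroup H] [InnerProductSpace ℝ H]

/-- `(E, D)` is a symmetric form on `H`: `D` is a dense linear subspace and `E` is a non-negative
definite symmetric bilinear form on `D`. -/
structure IsSymmetricForm (E : H → H → ℝ) (D : Set H) : Prop where
  zero_mem : (0 : H) ∈ D
  add_mem : ∀ f ∈ D, ∀ g ∈ D, f + g ∈ D
  smul_mem : ∀ (a : ℝ), ∀ f ∈ D, a • f ∈ D
  dense : Dense D
  nonneg : ∀ f ∈ D, 0 ≤ E f f
  symm : ∀ f ∈ D, ∀ g ∈ D, E f g = E g f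
  smul_left : ∀ (a : ℝ), ∀ f ∈ D, ∀ g ∈ D, E (a • f) g = a * E f g
  add_left : ∀ f₁ ∈ D, ∀ f₂ ∈ D, ∀ g ∈ D, E (f₁ + f₂) g = E f₁ g + E f₂ g

/-- The norm `‖f‖_{E₁} = √(E(f,f) + ‖f‖²)`. -/
def energyNorm (E : H → H → ℝ) (f : H) : ℝ := Real.sqrt (E f f + ‖f‖ ^ 2)

/-- `(E, D)` is a closed form: a symmetric form whose domain is complete for `energyNorm E`. -/
structure IsClosedForm (E : H → H → ℝ) (D : Set H) : Prop extends IsSymmetricForm E D where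
  complete : ∀ u : ℕ → H, (∀ n, u n ∈ D) →
    (∀ ε > 0, ∃ N, ∀ m ≥ N, ∀ n ≥ N, energyNorm E (u m - u n) < ε) →
    ∃ w ∈ D, Tendsto (fun n => energyNorm E (u n - w)) atTop (𝓝 0)

/-- `(E, D)` is closable: it has a closed extension. -/
def IsClosable (E : H → H → ℝ) (D : Set H) : Prop :=
  ∃ (E' : H → H → ℝ) (D' : Set H), IsClosedForm E' D' ∧ D ⊆ D' ∧
    ∀ f ∈ D, ∀ g ∈ D, E' f g = E f g

/-- The domain of the generator of `(E, D)`: those `u ∈ D` for which `E(u, ·)` is represented on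
`D` by a vector of `H`. -/
def generatorDomain (E : H → H → ℝ) (D : Set H) : Set H :=
  {u | u ∈ D ∧ ∃ w : H, ∀ v ∈ D, E u v = -inner ℝ w v}

open Classical in
/-- The generator of `(E, D)`: for `u` in its domain, `generator E D u` is the vector `w`
(unique since `D` is dense) with `E(u, v) = -(w, v)` for all `v ∈ D`. This is the negative
self-adjoint operator corresponding to `(E, D)` when `(E, D)` is a closed form. -/
def generator (E : H → H → ℝ) (D : Set H) (u : H) : H :=
  if h : u ∈ generatorDomain E D then h.2.choose else 0

end Forms

/-- `(E, D)` is a Dirichlet form on `L²(μ)`: a closed form such that for every `u ∈ D` the function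
`u⁺ ∧ 1` belongs to `D` and has energy at most `E(u, u)`. -/
structure IsDirichletForm {X : Type*} [MeasurableSpace X] {μ : Measure X}
    (E : Lp ℝ 2 μ → Lp ℝ 2 μ → ℝ) (D : Set (Lp ℝ 2 μ)) : Prop extends IsClosedForm E D where
  markov : ∀ u ∈ D, ∃ v ∈ D, (v =ᵐ[μ] fun p => min (max (u p) 0) 1) ∧ E v v ≤ E u u

/-! ### The weighted spaces -/

/-- The density `1 / (ρ̄ |x|^{β(1+j)})`, where `ρ̄ = √(1 - ρ²)`. -/
def weight (β ρ : ℝ) (j : ℕ) (p : ℝ × ℝ) : ℝ :=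
  1 / (Real.sqrt (1 - ρ ^ 2) * |p.1| ^ (β * (1 + j)))

/-- The measure `dx dy / (ρ̄ |x|^{β(1+j)})` on the plane. -/
def weightedMeasure (β ρ : ℝ) (j : ℕ) : Measure (ℝ × ℝ) :=
  (volume : Measure (ℝ × ℝ)).withDensity fun p => ENNReal.ofReal (weight β ρ j p)

/-- The Hilbert space `L²(dx dy / (ρ̄ |x|^{β(1+j)}))`. -/
abbrev WeightedL2 (β ρ : ℝ) (j : ℕ) : Type := Lp ℝ 2 (weightedMeasure β ρ j)

/-! ### Partial derivatives along lines -/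

/-- `w` is an absolutely continuous version of `h : ℝ → ℝ`: it is absolutely continuous on each
compact interval and agrees with `h` almost everywhere. -/
def IsACVersion (h w : ℝ → ℝ) : Prop :=
  (∀ a b : ℝ, AbsolutelyContinuousOnInterval w a b) ∧ w =ᵐ[volume] h

open Classical in
/-- The absolutely continuous version of `h` (unique if it exists; `0` if there is none). -/
def acVersion (h : ℝ → ℝ) : ℝ → ℝ :=
  if H : ∃ w, IsACVersion h w then H.choose else 0

/-- `∂u/∂x`: the derivative of the absolutely continuous version of `x ↦ u(x, ȳ)`. -/
def linePartialX (u : ℝ × ℝ → ℝ) (p : ℝ × ℝ) : ℝ := deriv (acVersion fun s => u (s, p.2)) p.1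

/-- `∂u/∂y`: the derivative of the absolutely continuous version of `y ↦ u(x̄, y)`. -/
def linePartialY (u : ℝ × ℝ → ℝ) (p : ℝ × ℝ) : ℝ := deriv (acVersion fun s => u (p.1, s)) p.2

/-! ### The bilinear forms -/

/-- The quadratic expression `|x|^{2β} a₁ b₁ + 2ρ |x|^β a₁ b₂ + a₂ b₂`, symmetrized in `a, b`
(`a = (a₁, a₂)` and `b = (b₁, b₂)` are gradients at the point `p = (x, y)`). -/
def coefForm (β ρ : ℝ) (p : ℝ × ℝ) (a₁ a₂ b₁ b₂ : ℝ) : ℝ :=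
  |p.1| ^ (2 * β) * (a₁ * b₁) + ρ * |p.1| ^ β * (a₁ * b₂ + a₂ * b₁) + a₂ * b₂

/-- `Γ̃(u, v)` with the partial derivatives taken along lines. -/
def Gam (β ρ : ℝ) (u v : ℝ × ℝ → ℝ) (p : ℝ × ℝ) : ℝ :=
  coefForm β ρ p (linePartialX u p) (linePartialY u p) (linePartialX v p) (linePartialY v p)

/-- The bilinear form `Ẽ(u, v) = ½ ∫ Γ̃(u, v) dx dy / (ρ̄ |x|^{β(1+j)})`. -/
def form (β ρ : ℝ) (j : ℕ) (u v : WeightedL2 β ρ j) : ℝ :=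
  (1 / 2) * ∫ p, Gam β ρ u v p ∂(weightedMeasure β ρ j)

/-- The domain of the Dirichlet form: `u ∈ L²` such that on almost every line parallel to a
coordinate axis `u` has an absolutely continuous version, and `Γ̃(u, u) ∈ L¹`. -/
def formDomain (β ρ : ℝ) (j : ℕ) : Set (WeightedL2 β ρ j) :=
  {u | (∀ᵐ y : ℝ, ∃ w, IsACVersion (fun x => u (x, y)) w) ∧
       (∀ᵐ x : ℝ, ∃ w, IsACVersion (fun y => u (x, y)) w) ∧
       Integrable (Gam β ρ u u) (weightedMeasure β ρ j)}

/-! ### Test functions and differential operators -/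

/-- `φ ∈ C₀^∞(U)`: smooth, with compact support contained in the open set `U` of the plane. -/
structure IsTestFunction (U : Set (ℝ × ℝ)) (φ : ℝ × ℝ → ℝ) : Prop where
  smooth : ContDiff ℝ ((⊤ : ℕ∞) : WithTop ℕ∞) φ
  compact : HasCompactSupport φ
  support : tsupport φ ⊆ U

/-- The classes in `L²` of the functions of `C₀^∞(ℝ²)`. -/
def testDomain (β ρ : ℝ) (j : ℕ) : Set (WeightedL2 β ρ j) :=
  {u | ∃ φ, IsTestFunction Set.univ φ ∧ u =ᵐ[weightedMeasure β ρ j] φ}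

/-- The open quadrant `(0, ∞)²`. -/
def quadrant : Set (ℝ × ℝ) := {p | 0 < p.1 ∧ 0 < p.2}

/-- The classical partial derivative `∂φ/∂x`. -/
def dx (φ : ℝ × ℝ → ℝ) (p : ℝ × ℝ) : ℝ := deriv (fun s => φ (s, p.2)) p.1

/-- The classical partial derivative `∂φ/∂y`. -/
def dy (φ : ℝ × ℝ → ℝ) (p : ℝ × ℝ) : ℝ := deriv (fun s => φ (p.1, s)) p.2

/-- The time-changed SABR generator
`Ã f = ½ (x^{2β} ∂ₓₓ f + 2ρ x^β ∂ₓᵧ f + ∂ᵧᵧ f)`, for `f` supported in the quadrant. -/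
def opA (β ρ : ℝ) (f : ℝ × ℝ → ℝ) (p : ℝ × ℝ) : ℝ :=
  (1 / 2) * (p.1 ^ (2 * β) * dx (dx f) p + 2 * ρ * p.1 ^ β * dx (dy f) p + dy (dy f) p)

/-- The time-changed Laplace-Beltrami operator `Δ̃_g f = (β/2) x^{2β-1} ∂ₓ f + Ã f`, for `f`
supported in the quadrant. -/
def opLaplace (β ρ : ℝ) (f : ℝ × ℝ → ℝ) (p : ℝ × ℝ) : ℝ :=
  β / 2 * p.1 ^ (2 * β - 1) * dx f p + opA β ρ f p

/-- On `C₀^∞((0,∞)²)` the generator `Φ(Ẽ)` of the form coincides with the differential operator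
`L`: for test functions `f₁, f₂`, `f₁` lies in the domain of `Φ(Ẽ)`, `Φ(Ẽ) f₁ = L f₁`, and
`(Φ(Ẽ) f₁, f₂) = (L f₁, f₂) = -Ẽ(f₁, f₂)`. -/
def GeneratorMatches (β ρ : ℝ) (j : ℕ) (L : (ℝ × ℝ → ℝ) → ℝ × ℝ → ℝ) : Prop :=
  ∀ f₁ f₂ : ℝ × ℝ → ℝ, IsTestFunction quadrant f₁ → IsTestFunction quadrant f₂ →
    ∃ (h₁ : MemLp f₁ 2 (weightedMeasure β ρ j)) (h₂ : MemLp f₂ 2 (weightedMeasure β ρ j))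
      (hL : MemLp (L f₁) 2 (weightedMeasure β ρ j)),
      h₁.toLp f₁ ∈ generatorDomain (form β ρ j) (formDomain β ρ j) ∧
      generator (form β ρ j) (formDomain β ρ j) (h₁.toLp f₁) = hL.toLp (L f₁) ∧
      inner ℝ (generator (form β ρ j) (formDomain β ρ j) (h₁.toLp f₁)) (h₂.toLp f₂)
        = inner ℝ (hL.toLp (L f₁)) (h₂.toLp f₂) ∧
      inner ℝ (hL.toLp (L f₁)) (h₂.toLp f₂) = -form β ρ j (h₁.toLp f₁) (h₂.toLp f₂)

end TimeChangedSABR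

end


/-!
Put `X = |x|^β ∂ₓ` and `Y = ∂ᵧ`. Then `Γ̃(u, u) = (Xu)² + 2ρ Xu Yu + (Yu)²` is, for `|ρ| < 1`,
comparable with `(Xu)² + (Yu)²` uniformly in the point, so everything reduces to the operator
`u ↦ (Xu, Yu)` from `L²` to `L² × L²`. This operator is closed: if `uₙ → u` and `X uₙ → A` in `L²`,
then along a subsequence both converge in `L²` on almost every horizontal line, and
`∂ₓ uₙ = |x|^{-β} X uₙ` converges in `L¹` on compact intervals of such a line because
`|x|^{-2β} |x|^{β(1+j)} = |x|^{-β(1-j)}` is locally integrable; the limit of absolutely continuous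
functions with `L¹`-convergent derivatives is absolutely continuous. The Markov property is the
chain rule on lines. On the quadrant the weight is smooth, and integration by parts on almost every
line identifies the generator.
-/

noncomputable section

namespace TimeChangedSABR

/-! ### Forms given by a bilinear form on a graph -/

section Graph

variable {H K : Type*} [NormedAddCommGroup H] [InnerProductSpace ℝ H]

theorem generator_eq_of_dense {E : H → H → ℝ} {D : Set H} (hD : Dense D) {u w : H} (hu : u ∈ D)
    (hw : ∀ v ∈ D, E u v = -inner ℝ w v) : u ∈ generatorDomain E D ∧ generator E D u = w := by
  have hmem : u ∈ generatorDomain E D := ⟨hu, w, hw⟩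
  refine ⟨hmem, ?_⟩
  rw [generator, dif_pos hmem]
  refine hD.eq_of_inner_left ℝ fun v hv => neg_injective ?_
  rw [← hmem.2.choose_spec v hv, hw v hv]

theorem isSymmetricForm_of_graph [AddCommGroup K] [Module ℝ K] {E : H → H → ℝ}
    {D : Submodule ℝ H} {G : Submodule ℝ (H × K)} {b : LinearMap.BilinForm ℝ K}
    (hb : b.IsPosSemidef) (hE : ∀ p ∈ G, ∀ q ∈ G, E p.1 q.1 = b p.2 q.2)
    (hDG : ∀ f ∈ D, ∃ k, (f, k) ∈ G) (hD : Dense (D : Set H)) : IsSymmetricForm E D where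
  zero_mem := D.zero_mem
  add_mem _ hf _ hg := D.add_mem hf hg
  smul_mem a _ hf := D.smul_mem a hf
  dense := hD
  nonneg f hf := by
    obtain ⟨k, hk⟩ := hDG f hf
    exact (hE _ hk _ hk).symm ▸ hb.nonneg k
  symm f hf g hg := by
    obtain ⟨k, hk⟩ := hDG f hf
    obtain ⟨l, hl⟩ := hDG g hg
    rw [hE _ hk _ hl, hE _ hl _ hk]
    exact hb.isSymm.eq k l
  smul_left a f hf g hg := by
    obtain ⟨k, hk⟩ := hDG f hf
    obtain ⟨l, hl⟩ := hDG g hg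
    have h := hE _ (G.smul_mem a hk) _ hl
    simp only [Prod.smul_fst, Prod.smul_snd, map_smul, LinearMap.smul_apply, smul_eq_mul] at h
    rw [h, hE _ hk _ hl]
  add_left f₁ hf₁ f₂ hf₂ g hg := by
    obtain ⟨k₁, hk₁⟩ := hDG f₁ hf₁
    obtain ⟨k₂, hk₂⟩ := hDG f₂ hf₂
    obtain ⟨l, hl⟩ := hDG g hg
    have h := hE _ (G.add_mem hk₁ hk₂) _ hl
    simp only [Prod.fst_add, Prod.snd_add, map_add, LinearMap.add_apply] at h
    rw [h, hE _ hk₁ _ hl, hE _ hk₂ _ hl]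

theorem cauchySeq_of_mul_norm_sub_le [SeminormedAddCommGroup K] {k : ℕ → K} {e : ℕ → ℕ → ℝ} {c : ℝ}
    (hc : 0 < c) (hk : ∀ m n, c * ‖k m - k n‖ ≤ e m n)
    (he : ∀ ε > 0, ∃ N, ∀ m ≥ N, ∀ n ≥ N, e m n < ε) : CauchySeq k := by
  refine Metric.cauchySeq_iff.2 fun ε hε =>
    (he (c * ε) (by positivity)).imp fun N hN m hm n hn => ?_
  rw [dist_eq_norm]
  exact lt_of_mul_lt_mul_left ((hk m n).trans_lt (hN m hm n hn)) hc.le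

theorem isClosedForm_of_isClosed_graph [CompleteSpace H] [NormedAddCommGroup K] [NormedSpace ℝ K]
    [CompleteSpace K] {E : H → H → ℝ} {G : Submodule ℝ (H × K)} {b : LinearMap.BilinForm ℝ K}
    {c : ℝ} (hb : b.IsSymm) (hc : 0 < c) (hcoer : ∀ k, c * ‖k‖ ^ 2 ≤ b k k)
    (hcont : Continuous fun k => b k k) (hG : IsClosed (G : Set (H × K)))
    (hE : ∀ p ∈ G, ∀ q ∈ G, E p.1 q.1 = b p.2 q.2)
    (hD : Dense (G.map (LinearMap.fst ℝ H K) : Set H)) :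
    IsClosedForm E (G.map (LinearMap.fst ℝ H K)) := by
  have hnonneg : ∀ k, 0 ≤ b k k := fun k => (by positivity : 0 ≤ c * ‖k‖ ^ 2).trans (hcoer k)
  have hDG : ∀ f ∈ G.map (LinearMap.fst ℝ H K), ∃ k, (f, k) ∈ G := by
    rintro _ ⟨p, hp, rfl⟩
    exact ⟨p.2, hp⟩
  have henergy : ∀ p ∈ G, energyNorm E p.1 = √(b p.2 p.2 + ‖p.1‖ ^ 2) := fun p hp => by
    rw [energyNorm, hE p hp p hp]
  refine ⟨isSymmetricForm_of_graph ⟨hb, ⟨hnonneg⟩⟩ hE hDG hD, fun u hu hcauchy => ?_⟩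
  choose k hk using fun n => hDG (u n) (hu n)
  have hdiff : ∀ m n, energyNorm E (u m - u n) = √(b (k m - k n) (k m - k n) + ‖u m - u n‖ ^ 2) :=
    fun m n => henergy _ (G.sub_mem (hk m) (hk n))
  have hu_cauchy : CauchySeq u := by
    refine cauchySeq_of_mul_norm_sub_le one_pos (fun m n => ?_) hcauchy
    rw [one_mul, hdiff]
    exact Real.le_sqrt_of_sq_le (le_add_of_nonneg_left (hnonneg _))
  have hk_cauchy : CauchySeq k := by
    refine cauchySeq_of_mul_norm_sub_le (Real.sqrt_pos.2 hc) (fun m n => ?_) hcauchy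
    rw [hdiff]
    refine Real.le_sqrt_of_sq_le ?_
    rw [mul_pow, Real.sq_sqrt hc.le]
    exact (hcoer _).trans (le_add_of_nonneg_right (sq_nonneg _))
  obtain ⟨w, hw⟩ := cauchySeq_tendsto_of_complete hu_cauchy
  obtain ⟨l, hl⟩ := cauchySeq_tendsto_of_complete hk_cauchy
  have hwl : (w, l) ∈ G :=
    hG.mem_of_tendsto (hw.prodMk_nhds hl) (Eventually.of_forall hk)
  refine ⟨w, ⟨(w, l), hwl, rfl⟩, ?_⟩
  have hlim : Tendsto (fun n => √(b (k n - l) (k n - l) + ‖u n - w‖ ^ 2)) atTop (𝓝 √(b 0 0 + 0)) :=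
    (((hcont.tendsto 0).comp (tendsto_sub_nhds_zero_iff.2 hl)).add
      (by simpa using (tendsto_iff_norm_sub_tendsto_zero.1 hw).pow 2)).sqrt
  rw [map_zero, add_zero, Real.sqrt_zero] at hlim
  exact hlim.congr fun n => (henergy _ (G.sub_mem (hk n) hwl)).symm

end Graph

/-! ### Absolutely continuous versions of functions of one variable -/

section ACVersion

variable {h h' h₁ h₂ w w₁ w₂ g : ℝ → ℝ}

theorem IsACVersion.continuous (H : IsACVersion h w) : Continuous w := by
  refine continuous_iff_continuousAt.2 fun x => ?_
  refine (H.1 (x - 1) (x + 1)).continuousOn.continuousAt ?_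
  rw [Set.uIcc_of_le (by linarith)]
  exact Icc_mem_nhds (by linarith) (by linarith)

theorem IsACVersion.unique (H₁ : IsACVersion h w₁) (H₂ : IsACVersion h w₂) : w₁ = w₂ :=
  (Continuous.ae_eq_iff_eq volume H₁.continuous H₂.continuous).1 (H₁.2.trans H₂.2.symm)

theorem IsACVersion.acVersion_eq (H : IsACVersion h w) : acVersion h = w := by
  have hex : ∃ w, IsACVersion h w := ⟨w, H⟩
  rw [acVersion, dif_pos hex]
  exact hex.choose_spec.unique H

theorem isACVersion_acVersion (hex : ∃ w, IsACVersion h w) : IsACVersion h (acVersion h) := by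
  obtain ⟨w, hw⟩ := hex
  rwa [hw.acVersion_eq]

theorem IsACVersion.congr (H : IsACVersion h w) (hh : h =ᵐ[volume] h') : IsACVersion h' w :=
  ⟨H.1, H.2.trans hh⟩

theorem IsACVersion.add (H₁ : IsACVersion h₁ w₁) (H₂ : IsACVersion h₂ w₂) :
    IsACVersion (h₁ + h₂) (w₁ + w₂) :=
  ⟨fun a b => (H₁.1 a b).add (H₂.1 a b), H₁.2.add H₂.2⟩

theorem IsACVersion.const_mul (c : ℝ) (H : IsACVersion h w) :
    IsACVersion (fun x => c * h x) (fun x => c * w x) :=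
  ⟨fun a b => (H.1 a b).const_mul c, H.2.fun_const_smul c⟩

theorem isACVersion_self_of_contDiff (hw : ContDiff ℝ 1 w) : IsACVersion w w :=
  ⟨fun _ _ => hw.contDiffOn.absolutelyContinuousOnInterval, ae_eq_rfl⟩

theorem IsACVersion.ae_differentiableAt (H : IsACVersion h w) :
    ∀ᵐ x : ℝ, DifferentiableAt ℝ w x := by
  have hn : ∀ n : ℕ, ∀ᵐ x : ℝ, x ∈ Set.uIcc (-(n : ℝ)) n → DifferentiableAt ℝ w x :=
    fun n => (H.1 _ _).ae_differentiableAt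
  filter_upwards [ae_all_iff.2 hn] with x hx
  obtain ⟨n, hxn⟩ := exists_nat_ge |x|
  exact hx n (Set.Icc_subset_uIcc (abs_le.1 hxn))

theorem locallyIntegrable_of_intervalIntegrable (hg : ∀ a b, IntervalIntegrable g volume a b) :
    LocallyIntegrable g := fun x =>
  ⟨Set.Icc (x - 1) (x + 1), Icc_mem_nhds (by linarith) (by linarith),
    (intervalIntegrable_iff_integrableOn_Icc_of_le (by linarith)).1 (hg _ _)⟩

theorem IsACVersion.locallyIntegrable_deriv (H : IsACVersion h w) :
    LocallyIntegrable (deriv w) :=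
  locallyIntegrable_of_intervalIntegrable fun a b => (H.1 a b).intervalIntegrable_deriv

theorem intervalIntegrable_of_locallyIntegrable (hg : LocallyIntegrable g) (a b : ℝ) :
    IntervalIntegrable g volume a b :=
  (hg.integrableOn_isCompact isCompact_uIcc).intervalIntegrable

theorem isACVersion_primitive (hg : LocallyIntegrable g) (c x₀ : ℝ) :
    IsACVersion (fun x => c + ∫ t in x₀..x, g t) (fun x => c + ∫ t in x₀..x, g t) := by
  refine ⟨fun a b => ?_, ae_eq_rfl⟩
  have hint := intervalIntegrable_of_locallyIntegrable hg
  have hshift : (fun x => c + ∫ t in x₀..x, g t)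
      = (fun _ => c + ∫ t in x₀..a, g t) + fun x => ∫ t in a..x, g t := by
    ext x
    simp only [Pi.add_apply]
    rw [add_assoc, intervalIntegral.integral_add_adjacent_intervals (hint x₀ a) (hint a x)]
  rw [hshift]
  exact contDiff_const.contDiffOn.absolutelyContinuousOnInterval.add
    ((hint a b).absolutelyContinuousOnInterval_intervalIntegral Set.left_mem_uIcc)

theorem deriv_primitive_ae_eq (hg : LocallyIntegrable g) (c x₀ : ℝ) :
    deriv (fun x => c + ∫ t in x₀..x, g t) =ᵐ[volume] g := by
  filter_upwards [LocallyIntegrable.ae_hasDerivAt_integral hg] with x hx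
  exact ((hx x₀).const_add c).deriv

theorem locallyIntegrable_of_tendsto_lintegral {X E : Type*} [TopologicalSpace X]
    [LocallyCompactSpace X] [MeasurableSpace X] [NormedAddCommGroup E] {μ : Measure X}
    {f : ℕ → X → E} {f' : X → E} (hf : ∀ n, LocallyIntegrable (f n) μ)
    (hf' : AEStronglyMeasurable f' μ)
    (hlim : ∀ K, IsCompact K → Tendsto (fun n => ∫⁻ x in K, ‖f n x - f' x‖ₑ ∂μ) atTop (𝓝 0)) :
    LocallyIntegrable f' μ := by
  refine locallyIntegrable_iff.2 fun K hK => ?_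
  obtain ⟨n, hn⟩ := ((hlim K hK).eventually_lt_const one_pos).exists
  have hfn : IntegrableOn (f n) K μ := (hf n).integrableOn_isCompact hK
  have hsub : IntegrableOn (f n - f') K μ :=
    ⟨hfn.aestronglyMeasurable.sub hf'.restrict, hn.trans ENNReal.one_lt_top⟩
  simpa using hfn.sub hsub

theorem IsACVersion.exists_of_tendsto {h w : ℕ → ℝ → ℝ} {h' g : ℝ → ℝ}
    (H : ∀ n, IsACVersion (h n) (w n)) (hg : AEStronglyMeasurable g)
    (hderiv : ∀ K, IsCompact K →
      Tendsto (fun n => ∫⁻ x in K, ‖deriv (w n) x - g x‖ₑ) atTop (𝓝 0))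
    (hlim : ∀ᵐ x : ℝ, Tendsto (fun n => h n x) atTop (𝓝 (h' x))) :
    ∃ v, IsACVersion h' v ∧ deriv v =ᵐ[volume] g := by
  have hgint : LocallyIntegrable g :=
    locallyIntegrable_of_tendsto_lintegral (fun n => (H n).locallyIntegrable_deriv) hg hderiv
  have hwlim : ∀ᵐ x : ℝ, Tendsto (fun n => w n x) atTop (𝓝 (h' x)) := by
    filter_upwards [hlim, ae_all_iff.2 fun n => (H n).2] with x hx hwx
    simpa only [hwx] using hx
  obtain ⟨x₀, hx₀⟩ := hwlim.exists
  refine ⟨_, (isACVersion_primitive hgint (h' x₀) x₀).congr ?_, deriv_primitive_ae_eq hgint _ _⟩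
  filter_upwards [hwlim] with x hx
  refine tendsto_nhds_unique ?_ hx
  have hint : Tendsto (fun n => ∫ t in x₀..x, deriv (w n) t) atTop (𝓝 (∫ t in x₀..x, g t)) := by
    simp only [intervalIntegral.intervalIntegral_eq_integral_uIoc]
    refine (tendsto_integral_of_L1 g hg.restrict (Eventually.of_forall fun n => ?_) ?_).const_smul _
    · exact (intervalIntegrable_of_locallyIntegrable (H n).locallyIntegrable_deriv x₀ x).def'
    · exact tendsto_of_tendsto_of_tendsto_of_le_of_le tendsto_const_nhds (hderiv _ isCompact_uIcc)
        (fun _ => zero_le) fun _ => lintegral_mono_set Set.uIoc_subset_uIcc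
  refine (hx₀.add hint).congr fun n => ?_
  rw [((H n).1 x₀ x).integral_deriv_eq_sub, add_sub_cancel]

/-- The unit contraction `t ↦ t⁺ ∧ 1`. -/
def unitContraction (t : ℝ) : ℝ := min (max t 0) 1

theorem lipschitzWith_unitContraction : LipschitzWith 1 unitContraction :=
  (LipschitzWith.id.max_const 0).min_const 1

theorem IsACVersion.unitContraction_comp (H : IsACVersion h w) :
    IsACVersion (unitContraction ∘ h) (unitContraction ∘ w) := by
  refine ⟨fun a b => squeeze_zero (fun t => Finset.sum_nonneg fun _ _ => dist_nonneg)
    (fun t => Finset.sum_le_sum fun i _ => ?_) (H.1 a b), H.2.fun_comp unitContraction⟩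
  simpa using lipschitzWith_unitContraction.dist_le_mul (w (t.2 i).1) (w (t.2 i).2)

theorem deriv_unitContraction_comp (hw : Continuous w) (x : ℝ) :
    deriv (unitContraction ∘ w) x = (w ⁻¹' Set.Ioo 0 1).indicator (deriv w) x := by
  by_cases hx : x ∈ w ⁻¹' Set.Ioo 0 1
  · rw [Set.indicator_of_mem hx]
    refine EventuallyEq.deriv_eq ?_
    filter_upwards [(isOpen_Ioo.preimage hw).mem_nhds hx] with z hz
    simp [unitContraction, hz.1.le, hz.2.le]
  -- Elsewhere `unitContraction ∘ w` attains its global minimum `0` or its global maximum `1`.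
  rw [Set.indicator_of_notMem hx]
  rcases le_or_gt (w x) 0 with hx₀ | hx₀
  · refine IsLocalMin.deriv_eq_zero (Eventually.of_forall fun z => ?_)
    simp [unitContraction, hx₀]
  · have hx₁ : 1 ≤ w x := not_lt.1 fun hlt => hx ⟨hx₀, hlt⟩
    refine IsLocalMax.deriv_eq_zero (Eventually.of_forall fun z => ?_)
    simp [unitContraction, hx₁]

end ACVersion

/-! ### Measurability of partial derivatives along lines -/

theorem measurable_continuousMap_of_eval {X Y Z : Type*} [TopologicalSpace X]
    [TopologicalSpace.SeparableSpace X] [MeasurableSpace Y] [TopologicalSpace Z] [T2Space Z]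
    [SecondCountableTopology Z] [MeasurableSpace Z] [BorelSpace Z] [PolishSpace C(X, Z)]
    [MeasurableSpace C(X, Z)] [BorelSpace C(X, Z)] {F : Y → C(X, Z)}
    (hF : ∀ x, Measurable fun y => F y x) : Measurable F := by
  obtain ⟨S, hS, hSd⟩ := TopologicalSpace.exists_countable_dense X
  have : Countable S := hS
  -- By Lusin–Souslin, restriction to a countable dense set is a measurable embedding.
  have hemb : MeasurableEmbedding fun (f : C(X, Z)) (s : S) => f s :=
    Continuous.measurableEmbedding (by fun_prop) fun f g hfg =>
      DFunLike.coe_injective <| f.continuous.ext_on hSd g.continuous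
        fun s hs => congrFun hfg ⟨s, hs⟩
  exact hemb.measurable_comp_iff.1 (measurable_pi_iff.2 fun s => hF s)

theorem tendsto_mul_setIntegral_Ioc {w : ℝ → ℝ} (hw : Continuous w) (x : ℝ) :
    Tendsto (fun n : ℕ => ((n : ℝ) + 1) * ∫ s in Set.Ioc x (x + ((n : ℝ) + 1)⁻¹), w s)
      atTop (𝓝 (w x)) := by
  have hderiv : HasDerivAt (fun t => ∫ s in x..t, w s) (w x) x :=
    intervalIntegral.integral_hasDerivAt_right (hw.intervalIntegrable _ _)
      (hw.stronglyMeasurableAtFilter _ _) hw.continuousAt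
  have hzero : Tendsto (fun n : ℕ => ((n : ℝ) + 1)⁻¹) atTop (𝓝[>] 0) :=
    tendsto_nhdsWithin_iff.2 ⟨by simpa using tendsto_one_div_add_atTop_nhds_zero_nat (𝕜 := ℝ),
      Eventually.of_forall fun n => Set.mem_Ioi.2 (by positivity)⟩
  refine (hderiv.tendsto_slope_zero_right.comp hzero).congr fun n => ?_
  have hle : x ≤ x + ((n : ℝ) + 1)⁻¹ := le_add_of_nonneg_right (by positivity)
  simp [intervalIntegral.integral_of_le hle]

theorem exists_measurable_continuousMap_acVersion {u : ℝ × ℝ → ℝ} (hu : StronglyMeasurable u)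
    (hex : ∀ᵐ y : ℝ, ∃ w, IsACVersion (fun x => u (x, y)) w) :
    ∃ F : ℝ → C(ℝ, ℝ), Measurable[_, borel C(ℝ, ℝ)] F ∧
      ∀ᵐ y : ℝ, F y = acVersion fun x => u (x, y) := by
  classical
  obtain ⟨N, hN, hNm, hN₀⟩ := exists_measurable_superset_of_null (ae_iff.1 hex)
  have hAC : ∀ y ∉ N, IsACVersion (fun x => u (x, y)) (acVersion fun x => u (x, y)) :=
    fun y hy => isACVersion_acVersion (not_not.1 fun hc => hy (hN hc))
  let F : ℝ → C(ℝ, ℝ) := fun y =>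
    if hy : y ∈ N then 0 else ⟨acVersion fun x => u (x, y), (hAC y hy).continuous⟩
  have hF : ∀ y ∉ N, (F y : ℝ → ℝ) = acVersion fun x => u (x, y) := fun y hy => by
    simp only [F, dif_neg hy]
    rfl
  borelize C(ℝ, ℝ)
  refine ⟨F, measurable_continuousMap_of_eval fun x => ?_, ?_⟩
  -- `F y x` is the limit of the means of `u (·, y)` over shrinking intervals at `x`.
  · refine measurable_of_tendsto_metrizable (f := fun (n : ℕ) => Nᶜ.indicator fun y =>
      ((n : ℝ) + 1) * ∫ s in Set.Ioc x (x + ((n : ℝ) + 1)⁻¹), u (s, y)) (fun n => ?_)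
      (tendsto_pi_nhds.2 fun y => ?_)
    · have hswap : StronglyMeasurable fun p : ℝ × ℝ => u p.swap :=
        hu.comp_measurable measurable_swap
      exact (hswap.integral_prod_right' (ν := volume.restrict _)).measurable.const_mul _
        |>.indicator hNm.compl
    · by_cases hy : y ∈ N
      · simp [F, hy]
      simp only [Set.indicator_of_mem (Set.mem_compl hy), hF y hy]
      refine (tendsto_mul_setIntegral_Ioc (hAC y hy).continuous x).congr fun n => ?_
      rw [integral_congr_ae (ae_restrict_of_ae (hAC y hy).2)]
  · filter_upwards [measure_eq_zero_iff_ae_notMem.1 hN₀] with y hy using hF y hy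

theorem aemeasurable_linePartialX {u : ℝ × ℝ → ℝ} (hu : StronglyMeasurable u)
    (hex : ∀ᵐ y : ℝ, ∃ w, IsACVersion (fun x => u (x, y)) w) : AEMeasurable (linePartialX u) := by
  borelize C(ℝ, ℝ)
  obtain ⟨F, hFm, hF⟩ := exists_measurable_continuousMap_acVersion hu hex
  have hderiv : Measurable fun p : C(ℝ, ℝ) × ℝ => deriv p.1 p.2 :=
    measurable_deriv_with_param (f := fun (f : C(ℝ, ℝ)) (x : ℝ) => f x) continuous_eval
  refine ⟨fun p => deriv (F p.2) p.1,
    hderiv.comp ((hFm.comp measurable_snd).prodMk measurable_fst), ?_⟩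
  filter_upwards [Measure.quasiMeasurePreserving_snd.ae hF] with p hp
  rw [hp, linePartialX]

/-! ### Almost everywhere statements on products and along subsequences -/

section AlmostEverywhere

variable {X Y : Type*} [MeasurableSpace X] [MeasurableSpace Y] {μ : Measure X} {ν : Measure Y}

theorem ae_prod_swap [SFinite μ] [SFinite ν] {P : X × Y → Prop} (h : ∀ᵐ p ∂μ.prod ν, P p) :
    ∀ᵐ q ∂ν.prod μ, P q.swap :=
  Measure.measurePreserving_swap.quasiMeasurePreserving.ae h

theorem ae_ae_of_ae_prod_symm [SFinite μ] [SFinite ν] {P : X × Y → Prop}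
    (h : ∀ᵐ p ∂μ.prod ν, P p) : ∀ᵐ y ∂ν, ∀ᵐ x ∂μ, P (x, y) :=
  Measure.ae_ae_of_ae_prod (ae_prod_swap h)

theorem ae_eq_of_ae_ae_eq_symm [SFinite μ] [SFinite ν] {Z : Type*} [MeasurableSpace Z]
    [MeasurableEq Z] {f g : X × Y → Z}
    (hf : AEMeasurable f (μ.prod ν)) (hg : AEMeasurable g (μ.prod ν))
    (h : ∀ᵐ y ∂ν, ∀ᵐ x ∂μ, f (x, y) = g (x, y)) : f =ᵐ[μ.prod ν] g := by
  have hmk : ∀ᵐ q ∂ν.prod μ, hf.mk f q.swap = hg.mk g q.swap := by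
    refine (Measure.ae_prod_iff_ae_ae (measurable_swap
      (measurableSet_eq_fun hf.measurable_mk hg.measurable_mk))).2 ?_
    filter_upwards [h, ae_ae_of_ae_prod_symm hf.ae_eq_mk, ae_ae_of_ae_prod_symm hg.ae_eq_mk]
      with y hy hfy hgy
    filter_upwards [hy, hfy, hgy] with x hx hfx hgx
    rw [Prod.swap_prod_mk, ← hfx, ← hgx, hx]
  filter_upwards [ae_prod_swap hmk, hf.ae_eq_mk, hg.ae_eq_mk] with p hp hfp hgp
  rw [hfp, hgp]
  exact hp

theorem exists_subseq_ae_tendsto_zero_of_lintegral {F : ℕ → X → ENNReal}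
    (hF : ∀ n, Measurable (F n)) (hlim : Tendsto (fun n => ∫⁻ x, F n x ∂μ) atTop (𝓝 0)) :
    ∃ φ : ℕ → ℕ, StrictMono φ ∧ ∀ᵐ x ∂μ, Tendsto (fun n => F (φ n) x) atTop (𝓝 0) := by
  obtain ⟨φ, hφ, hlt⟩ := extraction_forall_of_eventually fun k =>
    hlim.eventually_lt_const (ENNReal.pow_pos (by simp) k : (0 : ENNReal) < 2⁻¹ ^ k)
  have hsum : ∑' k, ∫⁻ x, F (φ k) x ∂μ ≠ ⊤ :=
    ne_top_of_le_ne_top (by simp [ENNReal.tsum_geometric])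
      (ENNReal.tsum_le_tsum fun k => (hlt k).le)
  rw [← lintegral_tsum fun k => (hF (φ k)).aemeasurable] at hsum
  refine ⟨φ, hφ, ?_⟩
  filter_upwards [ae_lt_top (Measurable.tsum fun k => hF (φ k)) hsum] with x hx
  exact ENNReal.tendsto_atTop_zero_of_tsum_ne_top hx.ne

theorem lintegral_mul_le_sqrt_mul_sqrt {f g W : X → ENNReal} (hf : AEMeasurable f μ)
    (hg : AEMeasurable g μ) (hW : AEMeasurable W μ) (hW₀ : ∀ᵐ x ∂μ, W x ≠ 0)
    (hW₁ : ∀ᵐ x ∂μ, W x ≠ ⊤) :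
    ∫⁻ x, f x * g x ∂μ ≤ (∫⁻ x, f x ^ 2 * W x ∂μ) ^ (1 / 2 : ℝ) *
      (∫⁻ x, g x ^ 2 * (W x)⁻¹ ∂μ) ^ (1 / 2 : ℝ) := by
  have hsq : ∀ a b : ENNReal, (a * b ^ (1 / 2 : ℝ)) ^ (2 : ℝ) = a ^ 2 * b := fun a b => by
    rw [ENNReal.mul_rpow_of_nonneg _ _ (by norm_num), ← ENNReal.rpow_mul]
    norm_num
  have hölder := ENNReal.lintegral_mul_le_Lp_mul_Lq μ Real.HolderConjugate.two_two
    (hf.mul (hW.pow_const (1 / 2 : ℝ))) (hg.mul (hW.inv.pow_const (1 / 2 : ℝ)))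
  simp only [Pi.mul_apply, Pi.inv_apply, hsq] at hölder
  refine le_trans (le_of_eq (lintegral_congr_ae ?_)) hölder
  filter_upwards [hW₀, hW₁] with x h₀ h₁
  rw [mul_mul_mul_comm, ← ENNReal.mul_rpow_of_nonneg _ _ (by norm_num),
    ENNReal.mul_inv_cancel h₀ h₁, ENNReal.one_rpow, mul_one]

end AlmostEverywhere

/-! ### Weighted partial derivatives along lines -/

theorem aemeasurable_linePartialY {u : ℝ × ℝ → ℝ} (hu : StronglyMeasurable u)
    (hex : ∀ᵐ x : ℝ, ∃ w, IsACVersion (fun y => u (x, y)) w) : AEMeasurable (linePartialY u) := by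
  have hswap : linePartialY u = linePartialX (u ∘ Prod.swap) ∘ Prod.swap := rfl
  obtain ⟨g, hg, hgu⟩ := aemeasurable_linePartialX (hu.comp_measurable measurable_swap) hex
  exact hswap ▸ ⟨g ∘ Prod.swap, hg.comp measurable_swap, ae_prod_swap hgu⟩

/-- On almost every horizontal line `u` has an absolutely continuous version `w`, and `c w' = A`
almost everywhere on that line. Vertical lines are treated by composing with `Prod.swap`. -/
def HasLinePartial (c u A : ℝ × ℝ → ℝ) : Prop :=
  ∀ᵐ y : ℝ, ∃ w, IsACVersion (fun x => u (x, y)) w ∧ ∀ᵐ x : ℝ, c (x, y) * deriv w x = A (x, y)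

namespace HasLinePartial

variable {c u u' A A' : ℝ × ℝ → ℝ}

theorem congr (H : HasLinePartial c u A) (hu : u =ᵐ[volume] u') (hA : A =ᵐ[volume] A') :
    HasLinePartial c u' A' := by
  filter_upwards [H, ae_ae_of_ae_prod_symm hu, ae_ae_of_ae_prod_symm hA] with y ⟨w, hw, hd⟩ huy hAy
  exact ⟨w, hw.congr huy, EventuallyEq.trans hd hAy⟩

theorem add (H : HasLinePartial c u A) (H' : HasLinePartial c u' A') :
    HasLinePartial c (u + u') (A + A') := by
  filter_upwards [H, H'] with y ⟨w, hw, hd⟩ ⟨w', hw', hd'⟩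
  refine ⟨w + w', hw.add hw', ?_⟩
  filter_upwards [hd, hd', hw.ae_differentiableAt, hw'.ae_differentiableAt] with x hx hx' hwx hwx'
  rw [deriv_add hwx hwx', mul_add, hx, hx', Pi.add_apply]

theorem const_mul (a : ℝ) (H : HasLinePartial c u A) :
    HasLinePartial c (fun p => a * u p) (fun p => a * A p) := by
  filter_upwards [H] with y ⟨w, hw, hd⟩
  refine ⟨_, hw.const_mul a, ?_⟩
  filter_upwards [hd] with x hx
  rw [deriv_const_mul_field, ← hx, mul_left_comm]

theorem unitContraction_comp (H : HasLinePartial c u A) :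
    HasLinePartial c (unitContraction ∘ u) ((u ⁻¹' Set.Ioo 0 1).indicator A) := by
  filter_upwards [H] with y ⟨w, hw, hd⟩
  refine ⟨_, hw.unitContraction_comp, ?_⟩
  filter_upwards [hd, hw.2] with x hx hwx
  rw [deriv_unitContraction_comp hw.continuous]
  simp only [Set.indicator, Set.mem_preimage, hwx, mul_ite, mul_zero, hx]

theorem exists_isACVersion (H : HasLinePartial c u A) :
    ∀ᵐ y : ℝ, ∃ w, IsACVersion (fun x => u (x, y)) w := by
  filter_upwards [H] with y ⟨w, hw, _⟩ using ⟨w, hw⟩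

theorem mul_linePartialX (H : HasLinePartial c u A) (hu : StronglyMeasurable u)
    (hc : Measurable c) (hA : AEMeasurable A) :
    (fun p => c p * linePartialX u p) =ᵐ[volume] A := by
  refine ae_eq_of_ae_ae_eq_symm
    (hc.aemeasurable.mul (aemeasurable_linePartialX hu H.exists_isACVersion)) hA ?_
  filter_upwards [H] with y ⟨w, hw, hd⟩
  simpa only [linePartialX, hw.acVersion_eq] using hd

theorem of_exists_isACVersion (hex : ∀ᵐ y : ℝ, ∃ w, IsACVersion (fun x => u (x, y)) w) :
    HasLinePartial c u fun p => c p * linePartialX u p := by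
  filter_upwards [hex] with y hy
  exact ⟨_, isACVersion_acVersion hy, ae_of_all _ fun x => rfl⟩

end HasLinePartial

theorem IsACVersion.exists_of_tendsto_weighted {h w V : ℕ → ℝ → ℝ} {h' c a : ℝ → ℝ}
    {W : ℝ → ENNReal} (hV : ∀ n, Measurable (V n)) (hc : Measurable c) (ha : Measurable a)
    (hW : Measurable W) (hc₀ : ∀ᵐ x, c x ≠ 0) (hW₀ : ∀ᵐ x, W x ≠ 0) (hW₁ : ∀ᵐ x, W x ≠ ⊤)
    (hloc : ∀ K, IsCompact K → ∫⁻ x in K, ‖(c x)⁻¹‖ₑ ^ 2 * (W x)⁻¹ ≠ ⊤)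
    (H : ∀ n, IsACVersion (h n) (w n)) (hderiv : ∀ n, ∀ᵐ x, c x * deriv (w n) x = V n x)
    (hVlim : Tendsto (fun n => ∫⁻ x, ‖V n x - a x‖ₑ ^ 2 * W x) atTop (𝓝 0))
    (hlim : ∀ᵐ x, Tendsto (fun n => h n x) atTop (𝓝 (h' x))) :
    ∃ v, IsACVersion h' v ∧ ∀ᵐ x, c x * deriv v x = a x := by
  have hle : ∀ K n, ∫⁻ x in K, ‖deriv (w n) x - (c x)⁻¹ * a x‖ₑ ≤
      (∫⁻ x, ‖V n x - a x‖ₑ ^ 2 * W x) ^ (1 / 2 : ℝ) *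
        (∫⁻ x in K, ‖(c x)⁻¹‖ₑ ^ 2 * (W x)⁻¹) ^ (1 / 2 : ℝ) := fun K n =>
    calc ∫⁻ x in K, ‖deriv (w n) x - (c x)⁻¹ * a x‖ₑ
        = ∫⁻ x in K, ‖V n x - a x‖ₑ * ‖(c x)⁻¹‖ₑ := by
          refine lintegral_congr_ae (ae_restrict_of_ae ?_)
          filter_upwards [hderiv n, hc₀] with x hx hcx
          rw [← enorm_mul, ← hx]
          congr 1
          field_simp
      _ ≤ _ := lintegral_mul_le_sqrt_mul_sqrt ((hV n).sub ha).enorm.aemeasurable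
          hc.inv.enorm.aemeasurable hW.aemeasurable (ae_restrict_of_ae hW₀) (ae_restrict_of_ae hW₁)
      _ ≤ _ := by
          gcongr
          exact Measure.restrict_le_self
  have hderiv_lim : ∀ K, IsCompact K →
      Tendsto (fun n => ∫⁻ x in K, ‖deriv (w n) x - (c x)⁻¹ * a x‖ₑ) atTop (𝓝 0) := fun K hK => by
    have hsqrt := ENNReal.Tendsto.mul_const (hVlim.ennrpow_const (1 / 2 : ℝ))
      (Or.inr (ENNReal.rpow_ne_top_of_nonneg (one_half_pos (α := ℝ)).le (hloc K hK)))
    rw [ENNReal.zero_rpow_of_pos one_half_pos, zero_mul] at hsqrt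
    exact tendsto_of_tendsto_of_tendsto_of_le_of_le tendsto_const_nhds hsqrt
      (fun _ => zero_le) (hle K)
  obtain ⟨v, hv, hvd⟩ := IsACVersion.exists_of_tendsto (g := fun x => (c x)⁻¹ * a x) H
    (hc.inv.mul ha).aestronglyMeasurable hderiv_lim hlim
  refine ⟨v, hv, ?_⟩
  filter_upwards [hvd, hc₀] with x hx hcx
  rw [hx, mul_inv_cancel_left₀ hcx]

theorem HasLinePartial.of_tendsto_lintegral {c u A : ℝ × ℝ → ℝ} {W : ℝ × ℝ → ENNReal}
    {U V : ℕ → ℝ × ℝ → ℝ} (hV : ∀ n, Measurable (V n)) (hc : Measurable c) (hA : Measurable A)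
    (hW : Measurable W) (hc₀ : ∀ᵐ p, c p ≠ 0) (hW₀ : ∀ᵐ p, W p ≠ 0) (hW₁ : ∀ᵐ p, W p ≠ ⊤)
    (hloc : ∀ᵐ y : ℝ, ∀ K, IsCompact K → ∫⁻ x in K, ‖(c (x, y))⁻¹‖ₑ ^ 2 * (W (x, y))⁻¹ ≠ ⊤)
    (H : ∀ n, HasLinePartial c (U n) (V n))
    (hVlim : Tendsto (fun n => ∫⁻ p, ‖V n p - A p‖ₑ ^ 2 * W p) atTop (𝓝 0))
    (hUlim : ∀ᵐ p, Tendsto (fun n => U n p) atTop (𝓝 (u p))) : HasLinePartial c u A := by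
  have hmeas : ∀ n, Measurable fun p => ‖V n p - A p‖ₑ ^ 2 * W p := fun n =>
    (((hV n).sub hA).enorm.pow_const 2).mul hW
  obtain ⟨φ, hφ, hline⟩ := exists_subseq_ae_tendsto_zero_of_lintegral (μ := (volume : Measure ℝ))
    (F := fun n y => ∫⁻ x, ‖V n (x, y) - A (x, y)‖ₑ ^ 2 * W (x, y))
    (fun n => (hmeas n).lintegral_prod_left')
    (hVlim.congr fun n => lintegral_prod_symm' _ (hmeas n))
  filter_upwards [ae_all_iff.2 H, hline, ae_ae_of_ae_prod_symm hUlim, hloc,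
    ae_ae_of_ae_prod_symm hc₀, ae_ae_of_ae_prod_symm hW₀, ae_ae_of_ae_prod_symm hW₁]
    with y hy hyV hyU hyloc hyc hyW₀ hyW₁
  choose w hw hwd using hy
  refine IsACVersion.exists_of_tendsto_weighted (fun n => (hV (φ n)).comp measurable_prodMk_right)
    (hc.comp measurable_prodMk_right) (hA.comp measurable_prodMk_right)
    (hW.comp measurable_prodMk_right) hyc hyW₀ hyW₁ hyloc (fun n => hw (φ n))
    (fun n => hwd (φ n)) hyV ?_
  filter_upwards [hyU] with x hx using hx.comp hφ.tendsto_atTop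

/-! ### The energy form of a pair of weighted derivatives -/

section EnergyForm

variable {H : Type*} [NormedAddCommGroup H] [InnerProductSpace ℝ H] {ρ : ℝ}

/-- The form `½ ((a₁, b₁) + ρ (a₁, b₂) + ρ (a₂, b₁) + (a₂, b₂))` on `H × H`. For `H = ℝ` it is half
of `coefForm` in the weighted derivatives `|x|^β ∂ₓ`, `∂ᵧ`; for `H = L²` it is the energy. -/
def energyForm (ρ : ℝ) : LinearMap.BilinForm ℝ (H × H) :=
  LinearMap.mk₂ ℝ
    (fun a b => 1 / 2 * (inner ℝ a.1 b.1 + ρ * (inner ℝ a.1 b.2 + inner ℝ a.2 b.1) +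
      inner ℝ a.2 b.2))
    (fun a a' b => by simp only [Prod.fst_add, Prod.snd_add, inner_add_left]; ring)
    (fun c a b => by
      simp only [Prod.smul_fst, Prod.smul_snd, real_inner_smul_left, smul_eq_mul]; ring)
    (fun a b b' => by simp only [Prod.fst_add, Prod.snd_add, inner_add_right]; ring)
    (fun c a b => by
      simp only [Prod.smul_fst, Prod.smul_snd, real_inner_smul_right, smul_eq_mul]; ring)

theorem energyForm_apply (a b : H × H) : energyForm ρ a b =
    1 / 2 * (inner ℝ a.1 b.1 + ρ * (inner ℝ a.1 b.2 + inner ℝ a.2 b.1) + inner ℝ a.2 b.2) := rfl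

theorem isSymm_energyForm : (energyForm ρ : LinearMap.BilinForm ℝ (H × H)).IsSymm where
  eq a b := by
    simp only [energyForm_apply, real_inner_comm b.1, real_inner_comm b.2]
    ring

theorem mul_norm_sq_le_energyForm_self (hρ : |ρ| ≤ 1) (a : H × H) :
    (1 - |ρ|) / 2 * ‖a‖ ^ 2 ≤ energyForm ρ a a := by
  have hnorm : ‖a‖ ^ 2 ≤ ‖a.1‖ ^ 2 + ‖a.2‖ ^ 2 := by
    rcases le_total ‖a.1‖ ‖a.2‖ with h | h
    · rw [Prod.norm_def, max_eq_right h]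
      exact le_add_of_nonneg_left (sq_nonneg _)
    · rw [Prod.norm_def, max_eq_left h]
      exact le_add_of_nonneg_right (sq_nonneg _)
  have hcross : |ρ * inner ℝ a.1 a.2| ≤ |ρ| * (‖a.1‖ * ‖a.2‖) := by
    rw [abs_mul]
    gcongr
    exact abs_real_inner_le_norm _ _
  rw [energyForm_apply, real_inner_comm a.1 a.2, real_inner_self_eq_norm_sq,
    real_inner_self_eq_norm_sq]
  nlinarith [neg_le_of_abs_le hcross, mul_nonneg (abs_nonneg ρ) (sq_nonneg (‖a.1‖ - ‖a.2‖)),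
    mul_le_mul_of_nonneg_left hnorm (sub_nonneg.2 hρ)]

theorem energyForm_self_nonneg (hρ : |ρ| ≤ 1) (a : H × H) : 0 ≤ energyForm ρ a a :=
  (mul_nonneg (by linarith) (sq_nonneg _)).trans (mul_norm_sq_le_energyForm_self hρ a)

theorem continuous_energyForm_self : Continuous fun a : H × H => energyForm ρ a a := by
  simp only [energyForm_apply]
  fun_prop

theorem integrable_energyForm {X : Type*} [MeasurableSpace X] {μ : Measure X}
    (a b : Lp H 2 μ × Lp H 2 μ) :
    Integrable (fun p => energyForm ρ (a.1 p, a.2 p) (b.1 p, b.2 p)) μ :=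
  (((L2.integrable_inner a.1 b.1).add (((L2.integrable_inner a.1 b.2).add
    (L2.integrable_inner a.2 b.1)).const_mul ρ)).add (L2.integrable_inner a.2 b.2)).const_mul _

theorem integral_energyForm {X : Type*} [MeasurableSpace X] {μ : Measure X}
    (a b : Lp H 2 μ × Lp H 2 μ) :
    ∫ p, energyForm ρ (a.1 p, a.2 p) (b.1 p, b.2 p) ∂μ = energyForm ρ a b := by
  have hint : ∀ f g : Lp H 2 μ, Integrable (fun p => inner ℝ (f p) (g p)) μ := L2.integrable_inner
  simp only [energyForm_apply, L2.inner_def]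
  rw [integral_const_mul, integral_add, integral_add, integral_const_mul, integral_add]
  all_goals first
    | exact hint _ _
    | exact (hint _ _).add (hint _ _)
    | exact ((hint _ _).add (hint _ _)).const_mul ρ
    | exact (hint _ _).add (((hint _ _).add (hint _ _)).const_mul ρ)

end EnergyForm

/-! ### The weighted measure -/

section WeightedMeasure

variable {β ρ : ℝ} {j : ℕ}

theorem sqrt_one_sub_sq_pos (hρ : |ρ| < 1) : 0 < √(1 - ρ ^ 2) :=
  Real.sqrt_pos.2 (sub_pos.2 ((sq_lt_one_iff_abs_lt_one ρ).2 hρ))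

theorem measurable_weight : Measurable (weight β ρ j) := by
  unfold weight
  fun_prop

theorem ae_fst_ne_zero : ∀ᵐ p : ℝ × ℝ, p.1 ≠ 0 :=
  (Measure.quasiMeasurePreserving_fst (μ := (volume : Measure ℝ))
    (ν := (volume : Measure ℝ))).ae (Measure.ae_ne volume 0)

theorem weight_nonneg (p : ℝ × ℝ) : 0 ≤ weight β ρ j p := by
  unfold weight
  positivity

theorem weight_pos (hρ : |ρ| < 1) {p : ℝ × ℝ} (hp : p.1 ≠ 0) : 0 < weight β ρ j p :=
  one_div_pos.2 (mul_pos (sqrt_one_sub_sq_pos hρ) (Real.rpow_pos_of_pos (abs_pos.2 hp) _))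

theorem ae_weight_ne_zero (hρ : |ρ| < 1) : ∀ᵐ p, ENNReal.ofReal (weight β ρ j p) ≠ 0 := by
  filter_upwards [ae_fst_ne_zero] with p hp
  exact (ENNReal.ofReal_pos.2 (weight_pos hρ hp)).ne'

theorem weightedMeasure_absolutelyContinuous : weightedMeasure β ρ j ≪ volume :=
  withDensity_absolutelyContinuous _ _

theorem ae_of_ae_weightedMeasure (hρ : |ρ| < 1) {P : ℝ × ℝ → Prop}
    (h : ∀ᵐ p ∂weightedMeasure β ρ j, P p) : ∀ᵐ p, P p :=
  (withDensity_absolutelyContinuous' measurable_weight.ennreal_ofReal.aemeasurable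
    (ae_weight_ne_zero hρ)).ae_le h

theorem lintegral_weightedMeasure (f : ℝ × ℝ → ENNReal) :
    ∫⁻ p, f p ∂weightedMeasure β ρ j = ∫⁻ p, f p * ENNReal.ofReal (weight β ρ j p) := by
  rw [weightedMeasure, lintegral_withDensity_eq_lintegral_mul_non_measurable _
    measurable_weight.ennreal_ofReal (by simp)]
  exact lintegral_congr fun p => mul_comm _ _

theorem integral_weightedMeasure (f : ℝ × ℝ → ℝ) :
    ∫ p, f p ∂weightedMeasure β ρ j = ∫ p, weight β ρ j p * f p := by
  rw [weightedMeasure, integral_withDensity_eq_integral_toReal_smul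
    measurable_weight.ennreal_ofReal (by simp)]
  simp only [ENNReal.toReal_ofReal (weight_nonneg _), smul_eq_mul]

theorem integrable_weightedMeasure_iff {f : ℝ × ℝ → ℝ} :
    Integrable f (weightedMeasure β ρ j) ↔ Integrable fun p => weight β ρ j p * f p := by
  rw [weightedMeasure, integrable_withDensity_iff_integrable_smul'
    measurable_weight.ennreal_ofReal (by simp)]
  simp only [ENNReal.toReal_ofReal (weight_nonneg _), smul_eq_mul]

theorem enorm_sq_eq_lintegral {X E : Type*} [MeasurableSpace X] {μ : Measure X}
    [NormedAddCommGroup E] (f : Lp E 2 μ) : ‖f‖ₑ ^ 2 = ∫⁻ x, ‖f x‖ₑ ^ 2 ∂μ := by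
  rw [Lp.enorm_def, eLpNorm_eq_lintegral_rpow_enorm_toReal (by norm_num) (by norm_num),
    ← ENNReal.rpow_natCast, ← ENNReal.rpow_mul]
  norm_num

theorem tendsto_lintegral_of_tendsto_Lp {u : ℕ → WeightedL2 β ρ j} {v : WeightedL2 β ρ j}
    (h : Tendsto u atTop (𝓝 v)) :
    Tendsto (fun n => ∫⁻ p, ‖u n p - v p‖ₑ ^ 2 * ENNReal.ofReal (weight β ρ j p)) atTop (𝓝 0) := by
  have hnorm : Tendsto (fun n => ‖u n - v‖ₑ ^ 2) atTop (𝓝 (0 ^ 2)) :=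
    ENNReal.Tendsto.pow (tendsto_zero_iff_enorm_tendsto_zero.1 (tendsto_sub_nhds_zero_iff.2 h))
  rw [zero_pow two_ne_zero] at hnorm
  refine hnorm.congr fun n => ?_
  rw [enorm_sq_eq_lintegral, ← lintegral_weightedMeasure]
  refine lintegral_congr_ae ?_
  filter_upwards [Lp.coeFn_sub (u n) v] with p hp
  rw [hp, Pi.sub_apply]

theorem locallyIntegrable_abs_rpow {r : ℝ} (hr : -1 < r) :
    LocallyIntegrable fun x : ℝ => |x| ^ r := by
  have hpos : ∀ R, 0 ≤ R → IntervalIntegrable (fun x : ℝ => |x| ^ r) volume 0 R := fun R hR => by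
    refine (intervalIntegral.intervalIntegrable_rpow' hr).congr fun x hx => ?_
    rw [Set.uIoc_of_le hR] at hx
    simp only [abs_of_pos hx.1]
  have hzero : ∀ R, IntervalIntegrable (fun x : ℝ => |x| ^ r) volume 0 R := fun R => by
    rcases le_total 0 R with hR | hR
    · exact hpos R hR
    · rw [IntervalIntegrable.iff_comp_neg]
      simpa only [abs_neg, neg_zero] using hpos (-R) (neg_nonneg.2 hR)
  exact locallyIntegrable_of_intervalIntegrable fun a b => (hzero a).symm.trans (hzero b)

end WeightedMeasure

/-! ### Weighted gradients -/

/-- `k` is the weighted gradient `(|x|^β ∂u/∂x, ∂u/∂y)` of `u`, with the partial derivatives taken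
along lines. -/
structure HasGradient {β ρ : ℝ} {j : ℕ} (u : WeightedL2 β ρ j)
    (k : WeightedL2 β ρ j × WeightedL2 β ρ j) : Prop where
  horizontal : HasLinePartial (fun p => |p.1| ^ β) u k.1
  vertical : HasLinePartial (fun _ => 1) (u ∘ Prod.swap) (k.2 ∘ Prod.swap)

section Gradient

variable {β ρ : ℝ} {j : ℕ} {u v : WeightedL2 β ρ j} {k l : WeightedL2 β ρ j × WeightedL2 β ρ j}

theorem coefForm_eq_energyForm (p : ℝ × ℝ) (a₁ a₂ b₁ b₂ : ℝ) : coefForm β ρ p a₁ a₂ b₁ b₂ =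
    2 * energyForm ρ (|p.1| ^ β * a₁, a₂) (|p.1| ^ β * b₁, b₂) := by
  rw [coefForm, energyForm_apply, mul_comm 2 β, Real.rpow_mul (abs_nonneg _), Real.rpow_two]
  simp only [RCLike.inner_apply, conj_trivial]
  ring

namespace HasGradient

theorem mul_linePartialX (H : HasGradient u k) :
    (fun p => |p.1| ^ β * linePartialX u p) =ᵐ[volume] k.1 :=
  H.horizontal.mul_linePartialX (Lp.stronglyMeasurable u) (by fun_prop)
    (Lp.stronglyMeasurable k.1).measurable.aemeasurable

theorem linePartialY_eq (H : HasGradient u k) : linePartialY u =ᵐ[volume] k.2 := by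
  have hswap := H.vertical.mul_linePartialX
    ((Lp.stronglyMeasurable u).comp_measurable measurable_swap) measurable_const
    ((Lp.stronglyMeasurable k.2).measurable.comp measurable_swap).aemeasurable
  filter_upwards [ae_prod_swap hswap] with p hp
  exact (one_mul _).symm.trans hp

theorem gam_eq (H : HasGradient u k) (H' : HasGradient v l) : Gam β ρ u v =ᵐ[weightedMeasure β ρ j]
    fun p => 2 * energyForm ρ (k.1 p, k.2 p) (l.1 p, l.2 p) := by
  refine weightedMeasure_absolutelyContinuous.ae_le ?_
  filter_upwards [H.mul_linePartialX, H'.mul_linePartialX, H.linePartialY_eq, H'.linePartialY_eq]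
    with p hkx hlx hky hly
  rw [Gam, coefForm_eq_energyForm, hkx, hlx, hky, hly]

theorem integrable_gam (H : HasGradient u k) (H' : HasGradient v l) :
    Integrable (Gam β ρ u v) (weightedMeasure β ρ j) :=
  ((integrable_energyForm _ _).const_mul 2).congr (H.gam_eq H').symm

theorem form_eq (H : HasGradient u k) (H' : HasGradient v l) :
    form β ρ j u v = energyForm ρ k l := by
  rw [form, integral_congr_ae (H.gam_eq H'), integral_const_mul, integral_energyForm]
  ring

theorem mem_formDomain (H : HasGradient u k) : u ∈ formDomain β ρ j :=
  ⟨H.horizontal.exists_isACVersion, H.vertical.exists_isACVersion, H.integrable_gam H⟩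

theorem zero (hρ : |ρ| < 1) :
    HasGradient (0 : WeightedL2 β ρ j) (0 : WeightedL2 β ρ j × WeightedL2 β ρ j) := by
  have hzero : (0 : ℝ × ℝ → ℝ) =ᵐ[volume] (0 : WeightedL2 β ρ j) :=
    EventuallyEq.symm (ae_of_ae_weightedMeasure hρ (Lp.coeFn_zero ℝ 2 _))
  have hline : ∀ c, HasLinePartial c 0 0 := fun c =>
    ae_of_all _ fun y => ⟨0, isACVersion_self_of_contDiff contDiff_const, by simp⟩
  exact ⟨(hline _).congr hzero hzero, (hline _).congr (ae_prod_swap hzero) (ae_prod_swap hzero)⟩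

theorem add (hρ : |ρ| < 1) (H : HasGradient u k) (H' : HasGradient v l) :
    HasGradient (u + v) (k + l) := by
  have hadd : ∀ f g : WeightedL2 β ρ j, (f + g : ℝ × ℝ → ℝ) =ᵐ[volume] (f + g : WeightedL2 β ρ j) :=
    fun f g => EventuallyEq.symm (ae_of_ae_weightedMeasure hρ (Lp.coeFn_add f g))
  exact ⟨(H.horizontal.add H'.horizontal).congr (hadd _ _) (hadd _ _),
    (H.vertical.add H'.vertical).congr (ae_prod_swap (hadd _ _)) (ae_prod_swap (hadd _ _))⟩

theorem const_smul (hρ : |ρ| < 1) (a : ℝ) (H : HasGradient u k) : HasGradient (a • u) (a • k) := by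
  have hsmul : ∀ f : WeightedL2 β ρ j, (fun p => a * f p) =ᵐ[volume] (a • f : WeightedL2 β ρ j) :=
    fun f => EventuallyEq.symm (ae_of_ae_weightedMeasure hρ (Lp.coeFn_smul a f))
  exact ⟨(H.horizontal.const_mul a).congr (hsmul _) (hsmul _),
    (H.vertical.const_mul a).congr (ae_prod_swap (hsmul _)) (ae_prod_swap (hsmul _))⟩

end HasGradient

/-- The graph of the weighted gradient, as a subspace of `L² × (L² × L²)`. -/
def gradientGraph (β : ℝ) (j : ℕ) (hρ : |ρ| < 1) :
    Submodule ℝ (WeightedL2 β ρ j × (WeightedL2 β ρ j × WeightedL2 β ρ j)) where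
  carrier := {q | HasGradient q.1 q.2}
  zero_mem' := .zero hρ
  add_mem' H H' := H.add hρ H'
  smul_mem' a _ H := H.const_smul hρ a

theorem exists_hasGradient (hρ : |ρ| < 1) (hu : u ∈ formDomain β ρ j) : ∃ k, HasGradient u k := by
  obtain ⟨hx, hy, hΓ⟩ := hu
  have hmeas : AEMeasurable fun p : ℝ × ℝ => (|p.1| ^ β * linePartialX u p, linePartialY u p) :=
    (AEMeasurable.mul (by fun_prop) (aemeasurable_linePartialX (Lp.stronglyMeasurable u) hx)).prodMk
      (aemeasurable_linePartialY (Lp.stronglyMeasurable u) hy)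
  have hmem : MemLp (fun p : ℝ × ℝ => (|p.1| ^ β * linePartialX u p, linePartialY u p)) 2
      (weightedMeasure β ρ j) := by
    have hmeas' := (hmeas.mono_ac (weightedMeasure_absolutelyContinuous
      (β := β) (ρ := ρ) (j := j))).aestronglyMeasurable
    refine (memLp_two_iff_integrable_sq_norm hmeas').2 ((hΓ.const_mul (1 - |ρ|)⁻¹).mono'
      (hmeas'.norm.pow 2) (ae_of_all _ fun p => ?_))
    rw [Real.norm_of_nonneg (sq_nonneg _), le_inv_mul_iff₀ (sub_pos.2 hρ), Gam,
      coefForm_eq_energyForm]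
    linarith [mul_norm_sq_le_energyForm_self hρ.le
      (|p.1| ^ β * linePartialX u p, linePartialY u p)]
  have hA := ae_of_ae_weightedMeasure hρ hmem.fst.coeFn_toLp
  have hB := ae_of_ae_weightedMeasure hρ hmem.snd.coeFn_toLp
  refine ⟨(hmem.fst.toLp _, hmem.snd.toLp _),
    (HasLinePartial.of_exists_isACVersion hx).congr ae_eq_rfl (EventuallyEq.symm hA),
    (HasLinePartial.of_exists_isACVersion (c := fun _ => 1) (u := u ∘ Prod.swap) hy).congr
      ae_eq_rfl ?_⟩
  filter_upwards [ae_prod_swap hB] with p hp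
  exact (one_mul _).trans hp.symm

theorem formDomain_eq_map_gradientGraph (hρ : |ρ| < 1) :
    formDomain β ρ j = (gradientGraph β j hρ).map (LinearMap.fst ℝ _ _) := by
  ext u
  constructor
  · intro hu
    obtain ⟨k, H⟩ := exists_hasGradient hρ hu
    exact ⟨(u, k), H, rfl⟩
  · rintro ⟨q, H, rfl⟩
    exact HasGradient.mem_formDomain H

theorem lintegral_inv_weight_ne_top (hρ : |ρ| < 1) (hβ : β * (1 - j) < 1) (y : ℝ) {K : Set ℝ}
    (hK : IsCompact K) :
    ∫⁻ x in K, ‖(|x| ^ β)⁻¹‖ₑ ^ 2 * (ENNReal.ofReal (weight β ρ j (x, y)))⁻¹ ≠ ⊤ := by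
  have hr : -1 < -(β * (1 - j)) := neg_lt_neg hβ
  have heq : (fun x => ‖(|x| ^ β)⁻¹‖ₑ ^ 2 * (ENNReal.ofReal (weight β ρ j (x, y)))⁻¹) =ᵐ[volume]
      fun x => ENNReal.ofReal (√(1 - ρ ^ 2) * |x| ^ (-(β * (1 - j)))) := by
    filter_upwards [Measure.ae_ne volume 0] with x hx
    have hx' := abs_pos.2 hx
    rw [← ENNReal.ofReal_inv_of_pos (weight_pos hρ hx), Real.enorm_of_nonneg (by positivity),
      ← ENNReal.ofReal_pow (by positivity), ← ENNReal.ofReal_mul (by positivity), weight, one_div,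
      inv_inv, mul_left_comm, ← Real.rpow_neg hx'.le, ← Real.rpow_natCast (_ ^ _),
      ← Real.rpow_mul hx'.le, ← Real.rpow_add hx']
    congr 3
    push_cast
    ring
  rw [lintegral_congr_ae (ae_restrict_of_ae heq)]
  have hint := (locallyIntegrable_abs_rpow hr).integrableOn_isCompact hK
  exact (hint.const_mul _).lintegral_lt_top.ne

namespace HasGradient

variable {U : ℕ → WeightedL2 β ρ j} {V : ℕ → WeightedL2 β ρ j × WeightedL2 β ρ j}

theorem horizontal_of_tendsto (hρ : |ρ| < 1) (hβ : β * (1 - j) < 1)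
    (H : ∀ n, HasGradient (U n) (V n))
    (hU : ∀ᵐ p, Tendsto (fun n => U n p) atTop (𝓝 (u p))) (hV : Tendsto V atTop (𝓝 k)) :
    HasLinePartial (fun p => |p.1| ^ β) u k.1 := by
  refine HasLinePartial.of_tendsto_lintegral (fun n => (Lp.stronglyMeasurable (V n).1).measurable)
    (by fun_prop) (Lp.stronglyMeasurable k.1).measurable measurable_weight.ennreal_ofReal ?_
    (ae_weight_ne_zero hρ) (ae_of_all _ fun _ => ENNReal.ofReal_ne_top)
    (ae_of_all _ fun y K hK => lintegral_inv_weight_ne_top hρ hβ y hK) (fun n => (H n).horizontal)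
    (tendsto_lintegral_of_tendsto_Lp hV.fst_nhds) hU
  filter_upwards [ae_fst_ne_zero] with p hp
  exact (Real.rpow_pos_of_pos (abs_pos.2 hp) β).ne'

theorem vertical_of_tendsto (hρ : |ρ| < 1) (H : ∀ n, HasGradient (U n) (V n))
    (hU : ∀ᵐ p, Tendsto (fun n => U n p) atTop (𝓝 (u p))) (hV : Tendsto V atTop (𝓝 k)) :
    HasLinePartial (fun _ => 1) (u ∘ Prod.swap) (k.2 ∘ Prod.swap) := by
  have hmeas : ∀ f : WeightedL2 β ρ j, Measurable (f ∘ Prod.swap) := fun f =>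
    (Lp.stronglyMeasurable f).measurable.comp measurable_swap
  refine HasLinePartial.of_tendsto_lintegral (fun n => hmeas (V n).2) measurable_const (hmeas k.2)
    ((measurable_weight (β := β) (ρ := ρ) (j := j)).ennreal_ofReal.comp measurable_swap) (by simp)
    (ae_prod_swap (ae_weight_ne_zero hρ)) (ae_of_all _ fun _ => ENNReal.ofReal_ne_top) ?_
    (fun n => (H n).vertical) ?_ (ae_prod_swap hU)
  · filter_upwards [Measure.ae_ne volume 0] with x hx K hK
    have hweight : (ENNReal.ofReal (weight β ρ j (x, 0)))⁻¹ ≠ ⊤ :=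
      ENNReal.inv_ne_top.2 (ENNReal.ofReal_pos.2 (weight_pos hρ hx)).ne'
    have hconst : ∀ y, weight β ρ j (x, y) = weight β ρ j (x, 0) := fun y => rfl
    simpa only [Function.comp_apply, Prod.swap_prod_mk, inv_one, enorm_one, one_pow, one_mul,
      hconst, setLIntegral_const] using ENNReal.mul_ne_top hweight hK.measure_ne_top
  · exact (tendsto_lintegral_of_tendsto_Lp hV.snd_nhds).congr fun n =>
      (lintegral_prod_swap (μ := volume) (ν := volume) _).symm

end HasGradient

theorem isClosed_gradientGraph (hρ : |ρ| < 1) (hβ : β * (1 - j) < 1) :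
    IsClosed (gradientGraph β j hρ :
      Set (WeightedL2 β ρ j × (WeightedL2 β ρ j × WeightedL2 β ρ j))) := by
  refine IsSeqClosed.isClosed fun q q' H hq => ?_
  obtain ⟨ns, hns, hae⟩ := (tendstoInMeasure_of_tendsto_Lp hq.fst_nhds).exists_seq_tendsto_ae
  have hU := ae_of_ae_weightedMeasure hρ hae
  have hV := hq.snd_nhds.comp hns.tendsto_atTop
  exact ⟨HasGradient.horizontal_of_tendsto hρ hβ (fun n => H (ns n)) hU hV,
    HasGradient.vertical_of_tendsto hρ (fun n => H (ns n)) hU hV⟩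

theorem isClosedForm_formDomain (hρ : |ρ| < 1) (hβ : β * (1 - j) < 1)
    (hdense : Dense (formDomain β ρ j)) : IsClosedForm (form β ρ j) (formDomain β ρ j) := by
  rw [formDomain_eq_map_gradientGraph hρ] at hdense ⊢
  exact isClosedForm_of_isClosed_graph isSymm_energyForm (half_pos (sub_pos.2 hρ))
    (mul_norm_sq_le_energyForm_self hρ.le) continuous_energyForm_self
    (isClosed_gradientGraph hρ hβ) (fun p H q H' => HasGradient.form_eq H H') hdense

theorem exists_unitContraction_mem_formDomain (hρ : |ρ| < 1) (hu : u ∈ formDomain β ρ j) :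
    ∃ v ∈ formDomain β ρ j, v =ᵐ[weightedMeasure β ρ j] unitContraction ∘ u ∧
      form β ρ j v v ≤ form β ρ j u u := by
  obtain ⟨k, H⟩ := exists_hasGradient hρ hu
  set S := (u : ℝ × ℝ → ℝ) ⁻¹' Set.Ioo 0 1
  have hS : MeasurableSet S := (Lp.stronglyMeasurable u).measurable measurableSet_Ioo
  have hv : MemLp (unitContraction ∘ u) 2 (weightedMeasure β ρ j) :=
    lipschitzWith_unitContraction.comp_memLp (by simp [unitContraction]) (Lp.memLp u)
  have hA := (Lp.memLp k.1).indicator hS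
  have hB := (Lp.memLp k.2).indicator hS
  have hv_ae := ae_of_ae_weightedMeasure hρ hv.coeFn_toLp
  have H' : HasGradient (hv.toLp _) (hA.toLp _, hB.toLp _) :=
    ⟨H.horizontal.unitContraction_comp.congr (EventuallyEq.symm hv_ae)
        (EventuallyEq.symm (ae_of_ae_weightedMeasure hρ hA.coeFn_toLp)),
      H.vertical.unitContraction_comp.congr (EventuallyEq.symm (ae_prod_swap hv_ae))
        (EventuallyEq.symm (ae_prod_swap (ae_of_ae_weightedMeasure hρ hB.coeFn_toLp)))⟩
  refine ⟨hv.toLp _, H'.mem_formDomain, hv.coeFn_toLp, ?_⟩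
  rw [H.form_eq H, H'.form_eq H', ← integral_energyForm, ← integral_energyForm]
  refine integral_mono_ae (integrable_energyForm _ _) (integrable_energyForm _ _) ?_
  filter_upwards [hA.coeFn_toLp, hB.coeFn_toLp] with p hAp hBp
  rw [hAp, hBp]
  by_cases hp : p ∈ S
  · simp only [Set.indicator_of_mem hp, le_refl]
  · simpa only [Set.indicator_of_notMem hp, ← Prod.zero_eq_mk, map_zero, LinearMap.zero_apply]
      using energyForm_self_nonneg hρ.le (k.1 p, k.2 p)

end Gradient

/-! ### Test functions -/

section TestFunctions

open scoped ContDiff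

variable {φ ψ : ℝ × ℝ → ℝ} {U V : Set (ℝ × ℝ)}

theorem hasDerivAt_dx {p : ℝ × ℝ} (hφ : DifferentiableAt ℝ φ p) :
    HasDerivAt (fun s => φ (s, p.2)) (dx φ p) p.1 :=
  (hφ.hasFDerivAt.comp_hasDerivAt p.1
    ((hasDerivAt_id p.1).prodMk (hasDerivAt_const p.1 p.2))).differentiableAt.hasDerivAt

theorem dx_eq_fderiv (hφ : Differentiable ℝ φ) : dx φ = fun p => fderiv ℝ φ p (1, 0) :=
  funext fun p => ((hφ p).hasFDerivAt.comp_hasDerivAt p.1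
    ((hasDerivAt_id p.1).prodMk (hasDerivAt_const p.1 p.2))).deriv

theorem dy_eq_fderiv (hφ : Differentiable ℝ φ) : dy φ = fun p => fderiv ℝ φ p (0, 1) :=
  funext fun p => ((hφ p).hasFDerivAt.comp_hasDerivAt p.2
    ((hasDerivAt_const p.2 p.1).prodMk (hasDerivAt_id p.2))).deriv

namespace IsTestFunction

theorem differentiable (hφ : IsTestFunction U φ) : Differentiable ℝ φ :=
  hφ.smooth.differentiable (by simp)

theorem eq_zero (hφ : IsTestFunction U φ) {p : ℝ × ℝ} (hp : p ∉ U) : φ p = 0 :=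
  image_eq_zero_of_notMem_tsupport fun h => hp (hφ.support h)

theorem mono (hUV : U ⊆ V) (hφ : IsTestFunction U φ) : IsTestFunction V φ :=
  ⟨hφ.smooth, hφ.compact, hφ.support.trans hUV⟩

theorem add (hφ : IsTestFunction U φ) (hψ : IsTestFunction U ψ) : IsTestFunction U (φ + ψ) :=
  ⟨hφ.smooth.add hψ.smooth, hφ.compact.add hψ.compact,
    (tsupport_add φ ψ).trans (Set.union_subset hφ.support hψ.support)⟩

theorem mul_left {a : ℝ × ℝ → ℝ} (hU : IsOpen U) (ha : ContDiffOn ℝ ∞ a U)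
    (hφ : IsTestFunction U φ) : IsTestFunction U fun p => a p * φ p where
  smooth := by
    have hzero : ContDiffOn ℝ ∞ (fun p => a p * φ p) (tsupport φ)ᶜ :=
      contDiffOn_const.congr fun p hp => by rw [image_eq_zero_of_notMem_tsupport hp, mul_zero]
    refine contDiff_of_contDiffOn_union_of_isOpen (ha.mul hφ.smooth.contDiffOn) hzero ?_ hU
      (isClosed_tsupport φ).isOpen_compl
    exact Set.eq_univ_of_forall fun p => (em (p ∈ tsupport φ)).imp (@hφ.support p) id
  compact := hφ.compact.mul_left
  support := tsupport_mul_subset_right.trans hφ.support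

theorem const_mul (c : ℝ) (hφ : IsTestFunction U φ) : IsTestFunction U fun p => c * φ p :=
  ⟨contDiff_const.mul hφ.smooth, hφ.compact.mul_left, tsupport_mul_subset_right.trans hφ.support⟩

theorem fderiv_apply (hφ : IsTestFunction U φ) (v : ℝ × ℝ) :
    IsTestFunction U fun p => fderiv ℝ φ p v :=
  ⟨(hφ.smooth.fderiv_right (m := ∞) (by simp)).clm_apply contDiff_const,
    hφ.compact.fderiv_apply ℝ v, (tsupport_fderiv_apply_subset ℝ v).trans hφ.support⟩

theorem dx (hφ : IsTestFunction U φ) : IsTestFunction U (dx φ) :=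
  dx_eq_fderiv hφ.differentiable ▸ hφ.fderiv_apply (1, 0)

theorem dy (hφ : IsTestFunction U φ) : IsTestFunction U (dy φ) :=
  dy_eq_fderiv hφ.differentiable ▸ hφ.fderiv_apply (0, 1)

theorem comp_swap (hφ : IsTestFunction U φ) : IsTestFunction (Prod.swap ⁻¹' U) (φ ∘ Prod.swap) where
  smooth := hφ.smooth.comp (contDiff_snd.prodMk contDiff_fst)
  compact := hφ.compact.comp_homeomorph (Homeomorph.prodComm ℝ ℝ)
  support := (tsupport_comp_subset_preimage φ continuous_swap).trans
    (Set.preimage_mono hφ.support)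

end IsTestFunction

theorem dx_dy_comm (hφ : IsTestFunction U φ) : dx (dy φ) = dy (dx φ) := by
  have hcomm : ∀ p v w, fderiv ℝ (fun q => fderiv ℝ φ q v) p w =
      fderiv ℝ (fderiv ℝ φ) p w v := fun p v w => by
    have hdiff : DifferentiableAt ℝ (fderiv ℝ φ) p :=
      (hφ.smooth.fderiv_right (m := ∞) (by simp)).differentiable (by simp) p
    rw [fderiv_clm_apply hdiff (differentiableAt_const v)]
    simp
  rw [dx_eq_fderiv hφ.dy.differentiable, dy_eq_fderiv hφ.dx.differentiable,
    dx_eq_fderiv hφ.differentiable, dy_eq_fderiv hφ.differentiable]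
  funext p
  rw [hcomm, hcomm]
  exact ((contDiff_infty.1 hφ.smooth 2).contDiffAt.isSymmSndFDerivAt (by simp)) _ _

/-- The complement of the line `x = 0`, where the weights and the coefficients are smooth. -/
def offAxis : Set (ℝ × ℝ) := {p | p.1 ≠ 0}

theorem isOpen_offAxis : IsOpen offAxis := isOpen_ne_fun continuous_fst continuous_const

theorem quadrant_subset_offAxis : quadrant ⊆ offAxis := fun _ hp => hp.1.ne'

theorem contDiffOn_fst_rpow (r : ℝ) : ContDiffOn ℝ ∞ (fun p : ℝ × ℝ => p.1 ^ r) offAxis :=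
  contDiffOn_fst.rpow_const_of_ne fun _ hp => hp

theorem contDiffOn_abs_fst_rpow (r : ℝ) : ContDiffOn ℝ ∞ (fun p : ℝ × ℝ => |p.1| ^ r) offAxis :=
  ContDiffOn.rpow_const_of_ne (fun _ hp => contDiffWithinAt_fst.abs hp) fun _ hp => abs_ne_zero.2 hp

theorem IsTestFunction.fst_rpow_mul (r : ℝ) (hφ : IsTestFunction quadrant φ) :
    IsTestFunction quadrant fun p => p.1 ^ r * φ p :=
  hφ.mul_left ((isOpen_lt continuous_const continuous_fst).inter
    (isOpen_lt continuous_const continuous_snd))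
    ((contDiffOn_fst_rpow r).mono quadrant_subset_offAxis)

theorem abs_fst_rpow_mul (r : ℝ) (hφ : IsTestFunction quadrant φ) :
    (fun p => |p.1| ^ r * φ p) = fun p => p.1 ^ r * φ p := by
  funext p
  by_cases hp : p ∈ quadrant
  · rw [abs_of_pos hp.1]
  · simp only [hφ.eq_zero hp, mul_zero]

theorem dx_fst_rpow_mul (r : ℝ) (hφ : IsTestFunction offAxis φ) :
    dx (fun p => p.1 ^ r * φ p) = fun p => p.1 ^ r * dx φ p + r * p.1 ^ (r - 1) * φ p := by
  funext p
  by_cases hp : p ∈ offAxis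
  · exact (((Real.hasDerivAt_rpow_const (Or.inl hp)).mul
      (hasDerivAt_dx (hφ.differentiable p))).congr_deriv (by ring)).deriv
  · have htest := hφ.mul_left isOpen_offAxis (contDiffOn_fst_rpow r)
    rw [htest.dx.eq_zero hp, hφ.dx.eq_zero hp, hφ.eq_zero hp, mul_zero, mul_zero, add_zero]

theorem dx_const_mul (c : ℝ) (φ : ℝ × ℝ → ℝ) : dx (fun p => c * φ p) = fun p => c * dx φ p :=
  funext fun _ => deriv_const_mul_field c

end TestFunctions

section TestFunctionGradients

variable {β ρ : ℝ} {j : ℕ} {φ ψ : ℝ × ℝ → ℝ} {U : Set (ℝ × ℝ)}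

theorem weight_eq (p : ℝ × ℝ) :
    weight β ρ j p = (√(1 - ρ ^ 2))⁻¹ * |p.1| ^ (-(β * (1 + j))) := by
  rw [weight, one_div, mul_inv, Real.rpow_neg (abs_nonneg _)]

theorem locallyIntegrable_abs_fst_rpow {r : ℝ} (hr : -1 < r) :
    LocallyIntegrable fun p : ℝ × ℝ => |p.1| ^ r := by
  refine (locallyIntegrable_iff).2 fun K hK => ?_
  have hint : IntegrableOn (fun p : ℝ × ℝ => |p.1| ^ r * 1)
      ((Prod.fst '' K) ×ˢ (Prod.snd '' K)) := by
    rw [IntegrableOn, Measure.volume_eq_prod, ← Measure.prod_restrict]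
    exact ((locallyIntegrable_abs_rpow hr).integrableOn_isCompact
      (hK.image continuous_fst)).mul_prod
      (integrableOn_const (hK.image continuous_snd).measure_lt_top.ne)
  simpa only [mul_one] using hint.mono_set fun p hp =>
    ⟨Set.mem_image_of_mem _ hp, Set.mem_image_of_mem _ hp⟩

theorem IsTestFunction.memLp_abs_fst_rpow_mul {r : ℝ} (hφ : IsTestFunction U φ)
    (hr : β * (1 + j) < 1 + 2 * r) :
    MemLp (fun p => |p.1| ^ r * φ p) 2 (weightedMeasure β ρ j) := by
  have hmeas : Measurable fun p : ℝ × ℝ => |p.1| ^ r * φ p :=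
    Measurable.mul (by fun_prop) hφ.smooth.continuous.measurable
  rw [memLp_two_iff_integrable_sq hmeas.aestronglyMeasurable, integrable_weightedMeasure_iff]
  have hint : Integrable fun p => φ p ^ 2 * |p.1| ^ (2 * r - β * (1 + j)) :=
    (locallyIntegrable_abs_fst_rpow (by linarith)).integrable_smul_left_of_hasCompactSupport
      (hφ.smooth.continuous.pow 2) (by simpa only [sq] using hφ.compact.mul_left)
  refine (hint.const_mul (√(1 - ρ ^ 2))⁻¹).congr ?_
  filter_upwards [ae_fst_ne_zero] with p hp
  have hp' := abs_pos.2 hp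
  rw [weight_eq, show 2 * r - β * (1 + j) = -(β * (1 + j)) + r + r by ring, Real.rpow_add hp',
    Real.rpow_add hp']
  ring

theorem IsTestFunction.memLp (hφ : IsTestFunction offAxis φ) :
    MemLp φ 2 (weightedMeasure β ρ j) := by
  have hmul := hφ.mul_left isOpen_offAxis (contDiffOn_abs_fst_rpow (-(β * (1 + j) / 2)))
  have hcancel :
      (fun p => |p.1| ^ (β * (1 + j) / 2) * (|p.1| ^ (-(β * (1 + j) / 2)) * φ p)) = φ := by
    funext p
    by_cases hp : p ∈ offAxis
    · rw [← mul_assoc, ← Real.rpow_add (abs_pos.2 hp), add_neg_cancel, Real.rpow_zero, one_mul]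
    · simp only [hφ.eq_zero hp, mul_zero]
  exact hcancel ▸ hmul.memLp_abs_fst_rpow_mul (by linarith)

theorem hasGradient_toLp (hρ : |ρ| < 1) (hφ : ContDiff ℝ 1 φ)
    (h : MemLp φ 2 (weightedMeasure β ρ j))
    (hx : MemLp (fun p => |p.1| ^ β * dx φ p) 2 (weightedMeasure β ρ j))
    (hy : MemLp (dy φ) 2 (weightedMeasure β ρ j)) :
    HasGradient (h.toLp φ) (hx.toLp _, hy.toLp _) := by
  have hae : ∀ {f : ℝ × ℝ → ℝ} (hf : MemLp f 2 (weightedMeasure β ρ j)), f =ᵐ[volume] hf.toLp f :=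
    fun hf => EventuallyEq.symm (ae_of_ae_weightedMeasure hρ hf.coeFn_toLp)
  have hX : HasLinePartial (fun p => |p.1| ^ β) φ (fun p => |p.1| ^ β * dx φ p) :=
    ae_of_all _ fun y => ⟨fun x => φ (x, y), isACVersion_self_of_contDiff (by fun_prop),
      ae_of_all _ fun x => rfl⟩
  have hY : HasLinePartial (fun _ => 1) (φ ∘ Prod.swap) (dy φ ∘ Prod.swap) :=
    ae_of_all _ fun x => ⟨fun y => φ (x, y),
      isACVersion_self_of_contDiff (hφ.comp (contDiff_const.prodMk contDiff_id)),
      ae_of_all _ fun y => one_mul _⟩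
  exact ⟨hX.congr (hae h) (hae hx), hY.congr (ae_prod_swap (hae h)) (ae_prod_swap (hae hy))⟩

theorem exists_hasGradient_toLp (hρ : |ρ| < 1) (hφ : IsTestFunction U φ)
    (hs : β * (1 + j) < 1) (hβ : -1 < β * (1 - j)) :
    ∃ (h : MemLp φ 2 (weightedMeasure β ρ j))
      (hx : MemLp (fun p => |p.1| ^ β * dx φ p) 2 (weightedMeasure β ρ j))
      (hy : MemLp (dy φ) 2 (weightedMeasure β ρ j)),
      HasGradient (h.toLp φ) (hx.toLp _, hy.toLp _) := by
  have hmem : ∀ {f}, IsTestFunction U f → MemLp f 2 (weightedMeasure β ρ j) := fun hf => by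
    simpa only [Real.rpow_zero, one_mul] using
      hf.memLp_abs_fst_rpow_mul (r := 0) (by linarith)
  exact ⟨hmem hφ, hφ.dx.memLp_abs_fst_rpow_mul (by linarith), hmem hφ.dy,
    hasGradient_toLp hρ (hφ.smooth.of_le (by simp)) _ _ _⟩

theorem hasGradient_toLp_of_offAxis (hρ : |ρ| < 1) (hφ : IsTestFunction offAxis φ)
    (hx : MemLp (fun p => |p.1| ^ β * dx φ p) 2 (weightedMeasure β ρ j)) :
    HasGradient (hφ.memLp.toLp φ) (hx.toLp _, hφ.dy.memLp.toLp _) :=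
  hasGradient_toLp hρ (hφ.smooth.of_le (by simp)) _ _ _

theorem exists_form_toLp_eq (hρ : |ρ| < 1) (hs : β * (1 + j) < 1) (hβ : -1 < β * (1 - j))
    (hφ : IsTestFunction U φ) (hψ : IsTestFunction U ψ) :
    ∃ (hφ' : MemLp φ 2 (weightedMeasure β ρ j)) (hψ' : MemLp ψ 2 (weightedMeasure β ρ j)),
      Integrable (fun p => coefForm β ρ p (dx φ p) (dy φ p) (dx ψ p) (dy ψ p))
        (weightedMeasure β ρ j) ∧
      form β ρ j (hφ'.toLp φ) (hψ'.toLp ψ) =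
        (1 / 2) * ∫ p, coefForm β ρ p (dx φ p) (dy φ p) (dx ψ p) (dy ψ p)
          ∂(weightedMeasure β ρ j) := by
  obtain ⟨hφ', hφx, hφy, H⟩ := exists_hasGradient_toLp hρ hφ hs hβ
  obtain ⟨hψ', hψx, hψy, H'⟩ := exists_hasGradient_toLp hρ hψ hs hβ
  have hΓ : Gam β ρ (hφ'.toLp φ) (hψ'.toLp ψ) =ᵐ[weightedMeasure β ρ j]
      fun p => coefForm β ρ p (dx φ p) (dy φ p) (dx ψ p) (dy ψ p) := by
    filter_upwards [H.gam_eq H', hφx.coeFn_toLp, hφy.coeFn_toLp, hψx.coeFn_toLp, hψy.coeFn_toLp]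
      with p hp h₁ h₂ h₃ h₄
    rw [hp, coefForm_eq_energyForm, h₁, h₂, h₃, h₄]
  exact ⟨hφ', hψ', (H.integrable_gam H').congr hΓ, by rw [form, integral_congr_ae hΓ]⟩

/-- The classes in `L²` of the test functions supported in `U`; `testDomain` is the case of the
whole plane. -/
def testSubmodule (β ρ : ℝ) (j : ℕ) (U : Set (ℝ × ℝ)) : Submodule ℝ (WeightedL2 β ρ j) where
  carrier := {u | ∃ φ, IsTestFunction U φ ∧ u =ᵐ[weightedMeasure β ρ j] φ}
  zero_mem' := ⟨0, ⟨contDiff_const, .zero, by simp⟩, Lp.coeFn_zero ℝ 2 _⟩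
  add_mem' := by
    rintro u v ⟨φ, hφ, hu⟩ ⟨ψ, hψ, hv⟩
    exact ⟨φ + ψ, hφ.add hψ, (Lp.coeFn_add u v).trans (hu.add hv)⟩
  smul_mem' := by
    rintro a u ⟨φ, hφ, hu⟩
    exact ⟨_, hφ.const_mul a, (Lp.coeFn_smul a u).trans (hu.const_smul a)⟩

theorem testSubmodule_offAxis_subset_formDomain (hρ : |ρ| < 1) :
    (testSubmodule β ρ j offAxis : Set (WeightedL2 β ρ j)) ⊆ formDomain β ρ j := by
  rintro u ⟨φ, hφ, hu⟩
  obtain rfl : u = hφ.memLp.toLp φ := Lp.ext (hu.trans hφ.memLp.coeFn_toLp.symm)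
  exact (hasGradient_toLp_of_offAxis hρ hφ
    (hφ.dx.mul_left isOpen_offAxis (contDiffOn_abs_fst_rpow β)).memLp).mem_formDomain

theorem weightedMeasure_lt_top_of_isCompact {K : Set (ℝ × ℝ)} (hK : IsCompact K)
    (hKU : K ⊆ offAxis) : weightedMeasure β ρ j K < ⊤ := by
  have hcont : ContinuousOn (weight β ρ j) K := by
    rw [funext weight_eq]
    exact continuousOn_const.mul ((contDiffOn_abs_fst_rpow _).continuousOn.mono hKU)
  rw [weightedMeasure, withDensity_apply _ hK.measurableSet]
  exact (hcont.integrableOn_compact hK).lintegral_lt_top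

theorem dense_testSubmodule_offAxis :
    Dense (testSubmodule β ρ j offAxis : Set (WeightedL2 β ρ j)) := by
  rw [Submodule.dense_iff_topologicalClosure_eq_top, Submodule.topologicalClosure_eq_top_iff,
    Submodule.eq_bot_iff]
  intro w hw
  have hloc : LocallyIntegrableOn w offAxis (weightedMeasure β ρ j) := by
    refine (locallyIntegrableOn_iff isOpen_offAxis.isLocallyClosed).2 fun K hKU hK => ?_
    have : Fact (weightedMeasure β ρ j K < ⊤) := ⟨weightedMeasure_lt_top_of_isCompact hK hKU⟩
    exact ((Lp.memLp w).restrict K).integrable one_le_two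
  have hzero := isOpen_offAxis.ae_eq_zero_of_integral_contDiff_smul_eq_zero hloc
    fun φ hφ hcompact hsupp => by
      have htest : IsTestFunction offAxis φ := ⟨hφ, hcompact, hsupp⟩
      rw [← (Submodule.mem_orthogonal' _ _).1 hw (htest.memLp.toLp φ)
        ⟨φ, htest, htest.memLp.coeFn_toLp⟩, L2.inner_def]
      refine integral_congr_ae ?_
      filter_upwards [htest.memLp.coeFn_toLp] with p hp
      simp only [hp, RCLike.inner_apply, conj_trivial, smul_eq_mul]
  refine Lp.ext (EventuallyEq.trans ?_ (Lp.coeFn_zero ℝ 2 _).symm)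
  filter_upwards [hzero, weightedMeasure_absolutelyContinuous.ae_le ae_fst_ne_zero] with p hp hp'
  exact hp hp'

theorem dense_formDomain (hρ : |ρ| < 1) : Dense (formDomain β ρ j) :=
  dense_testSubmodule_offAxis.mono (testSubmodule_offAxis_subset_formDomain hρ)

theorem isDirichletForm_formDomain (hρ : |ρ| < 1) (hβ : β * (1 - j) < 1) :
    IsDirichletForm (form β ρ j) (formDomain β ρ j) where
  toIsClosedForm := isClosedForm_formDomain hρ hβ (dense_formDomain hρ)
  markov _ := exists_unitContraction_mem_formDomain hρ

theorem exists_hasGradient_of_mem_testDomain (hρ : |ρ| < 1) (hs : β * (1 + j) < 1)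
    (hβ : -1 < β * (1 - j)) {u : WeightedL2 β ρ j} (hu : u ∈ testDomain β ρ j) :
    ∃ k, HasGradient u k := by
  obtain ⟨φ, hφ, hu⟩ := hu
  obtain ⟨hφ', hφx, hφy, H⟩ := exists_hasGradient_toLp hρ hφ hs hβ
  obtain rfl : u = hφ'.toLp φ := Lp.ext (hu.trans hφ'.coeFn_toLp.symm)
  exact ⟨_, H⟩

theorem isSymmetricForm_testDomain (hρ : |ρ| < 1) (hs : β * (1 + j) < 1)
    (hβ : -1 < β * (1 - j)) : IsSymmetricForm (form β ρ j) (testDomain β ρ j) :=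
  isSymmetricForm_of_graph (D := testSubmodule β ρ j Set.univ) (G := gradientGraph β j hρ)
    ⟨isSymm_energyForm, ⟨energyForm_self_nonneg hρ.le⟩⟩
    (fun _ H _ H' => HasGradient.form_eq H H')
    (fun _ hu => exists_hasGradient_of_mem_testDomain hρ hs hβ hu)
    (dense_testSubmodule_offAxis.mono fun _ hu =>
      hu.imp fun _ h => ⟨h.1.mono (Set.subset_univ _), h.2⟩)

theorem isClosable_testDomain (hρ : |ρ| < 1) (hs : β * (1 + j) < 1) (hβ : |β * (1 - j)| < 1) :
    IsClosable (form β ρ j) (testDomain β ρ j) :=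
  ⟨form β ρ j, formDomain β ρ j,
    (isDirichletForm_formDomain hρ (lt_of_abs_lt hβ)).toIsClosedForm, fun _ hu =>
      (exists_hasGradient_of_mem_testDomain hρ hs (neg_lt_of_abs_lt hβ) hu).elim
        fun _ H => H.mem_formDomain,
    fun _ _ _ _ => rfl⟩

end TestFunctionGradients

/-! ### Integration by parts and the generator -/

section Generator

theorem IsACVersion.integral_mul_deriv {h w ψ : ℝ → ℝ} (H : IsACVersion h w)
    (hψ : ContDiff ℝ 1 ψ) (hc : HasCompactSupport ψ) :
    ∫ x, ψ x * deriv w x = -∫ x, deriv ψ x * h x := by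
  obtain ⟨R, hR₀, hR⟩ := hc.isBounded.subset_ball_lt 0 0
  have hsupp : ∀ {f : ℝ → ℝ}, Function.support f ⊆ tsupport ψ →
      Function.support f ⊆ Set.Ioc (-R) R := fun hf => by
    refine (hf.trans hR).trans ?_
    rw [Real.ball_eq_Ioo, zero_sub, zero_add]
    exact Set.Ioo_subset_Ioc_self
  have hzero : ∀ x, x ∉ Metric.ball (0 : ℝ) R → ψ x = 0 := fun x hx =>
    image_eq_zero_of_notMem_tsupport fun hx' => hx (hR hx')
  have hparts := hψ.contDiffOn.absolutelyContinuousOnInterval.integral_mul_deriv_eq_deriv_mul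
    (H.1 (-R) R)
  rw [hzero R (by simp [abs_of_pos hR₀]), hzero (-R) (by simp [abs_of_pos hR₀]), zero_mul,
    zero_mul, sub_zero, zero_sub,
    intervalIntegral.integral_eq_integral_of_support_subset
      (hsupp ((Function.support_mul_subset_left _ _).trans subset_closure)),
    intervalIntegral.integral_eq_integral_of_support_subset
      (hsupp ((Function.support_mul_subset_left _ _).trans (support_deriv_subset)))] at hparts
  rw [hparts]
  refine congrArg _ (integral_congr_ae ?_)
  filter_upwards [H.2] with x hx
  rw [hx]

theorem HasLinePartial.integral_mul {c u A θ : ℝ × ℝ → ℝ} {U : Set (ℝ × ℝ)}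
    (H : HasLinePartial c u A) (hθ : IsTestFunction U fun p => θ p * c p)
    (hA : Integrable fun p => θ p * A p)
    (hu : Integrable fun p => dx (fun q => θ q * c q) p * u p) :
    ∫ p, θ p * A p = -∫ p, dx (fun q => θ q * c q) p * u p := by
  rw [Measure.volume_eq_prod] at *
  rw [integral_prod_symm _ hA, integral_prod_symm _ hu, ← integral_neg]
  refine integral_congr_ae ?_
  filter_upwards [H] with y ⟨w, hw, hd⟩
  have hline := hw.integral_mul_deriv (ψ := fun x => θ (x, y) * c (x, y))
    ((hθ.smooth.of_le (by simp)).comp (contDiff_id.prodMk contDiff_const))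
    (.of_support_subset_isCompact (hθ.compact.isCompact.image continuous_fst) fun x hx =>
      ⟨(x, y), subset_tsupport _ hx, rfl⟩)
  refine Eq.trans (integral_congr_ae ?_) hline
  filter_upwards [hd] with x hx
  rw [← hx, mul_assoc]

variable {β ρ : ℝ} {j : ℕ} {f g : ℝ × ℝ → ℝ}

theorem inner_toLp (hg : MemLp g 2 (weightedMeasure β ρ j)) (v : WeightedL2 β ρ j) :
    inner ℝ (hg.toLp g) v = ∫ p, weight β ρ j p * g p * v p := by
  simp only [mul_assoc]
  rw [L2.inner_def, ← integral_weightedMeasure]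
  refine integral_congr_ae ?_
  filter_upwards [hg.coeFn_toLp] with p hp
  rw [hp, RCLike.inner_apply, conj_trivial, mul_comm]

theorem integrable_weight_mul (hg : MemLp g 2 (weightedMeasure β ρ j)) (v : WeightedL2 β ρ j) :
    Integrable fun p => weight β ρ j p * g p * v p := by
  simp only [mul_assoc]
  exact integrable_weightedMeasure_iff.1 (hg.integrable_mul (Lp.memLp v))

theorem IsTestFunction.memLp_of_quadrant (hg : IsTestFunction quadrant g) :
    MemLp g 2 (weightedMeasure β ρ j) :=
  (hg.mono quadrant_subset_offAxis).memLp

theorem IsTestFunction.weight_mul (hg : IsTestFunction offAxis g) :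
    IsTestFunction offAxis fun p => weight β ρ j p * g p := by
  refine hg.mul_left isOpen_offAxis ?_
  rw [funext weight_eq]
  exact contDiffOn_const.mul (contDiffOn_abs_fst_rpow _)

theorem weight_mul_fst_rpow_mul (r : ℝ) (hg : IsTestFunction quadrant g) (p : ℝ × ℝ) :
    weight β ρ j p * (p.1 ^ r * g p) =
      (√(1 - ρ ^ 2))⁻¹ * (p.1 ^ (r - β * (1 + j)) * g p) := by
  by_cases hp : p ∈ quadrant
  · rw [weight_eq, abs_of_pos hp.1, show r - β * (1 + j) = -(β * (1 + j)) + r by ring,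
      Real.rpow_add hp.1]
    ring
  · simp only [hg.eq_zero hp, mul_zero]

/-- The negative of the formal adjoint of `|x|^β ∂/∂x` in `L²(dx dy / (ρ̄ |x|^{β(1+j)}))`, for
functions supported in the quadrant. -/
def adjX (β : ℝ) (j : ℕ) (g : ℝ × ℝ → ℝ) (p : ℝ × ℝ) : ℝ :=
  p.1 ^ β * dx g p - β * j * (p.1 ^ (β - 1) * g p)

theorem IsTestFunction.adjX (hg : IsTestFunction quadrant g) :
    IsTestFunction quadrant (adjX β j g) := by
  convert (hg.dx.fst_rpow_mul β).add ((hg.fst_rpow_mul (β - 1)).const_mul (-(β * j))) using 1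
  funext p
  simp only [TimeChangedSABR.adjX, Pi.add_apply]
  ring

theorem dx_weight_mul_mul_abs_rpow (hg : IsTestFunction quadrant g) :
    dx (fun p => weight β ρ j p * g p * |p.1| ^ β) = fun p => weight β ρ j p * adjX β j g p := by
  have heq : (fun p => weight β ρ j p * g p * |p.1| ^ β) =
      fun p => (√(1 - ρ ^ 2))⁻¹ * (p.1 ^ (β - β * (1 + j)) * g p) := by
    funext p
    rw [← weight_mul_fst_rpow_mul β hg, ← congrFun (abs_fst_rpow_mul β hg) p]
    ring
  rw [heq, dx_const_mul, dx_fst_rpow_mul _ (hg.mono quadrant_subset_offAxis)]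
  funext p
  rw [adjX, mul_sub, mul_left_comm _ (β * j), weight_mul_fst_rpow_mul β hg.dx,
    weight_mul_fst_rpow_mul (β - 1) hg, sub_right_comm]
  ring

variable {v : WeightedL2 β ρ j} {k : WeightedL2 β ρ j × WeightedL2 β ρ j}

theorem HasGradient.inner_fst (H : HasGradient v k) (hg : IsTestFunction quadrant g) :
    inner ℝ (hg.memLp_of_quadrant.toLp g) k.1 =
      -inner ℝ ((hg.adjX (β := β) (j := j)).memLp_of_quadrant.toLp _) v := by
  have htest : IsTestFunction offAxis fun p => weight β ρ j p * g p * |p.1| ^ β := by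
    simpa only [mul_comm] using (hg.mono quadrant_subset_offAxis).weight_mul.mul_left
      isOpen_offAxis (contDiffOn_abs_fst_rpow β)
  have hparts := H.horizontal.integral_mul htest (integrable_weight_mul hg.memLp_of_quadrant k.1)
  simp only [dx_weight_mul_mul_abs_rpow hg] at hparts
  rw [inner_toLp, inner_toLp]
  exact hparts (integrable_weight_mul hg.adjX.memLp_of_quadrant v)

theorem HasGradient.inner_snd (H : HasGradient v k) (hg : IsTestFunction quadrant g) :
    inner ℝ (hg.memLp_of_quadrant.toLp g) k.2 =
      -inner ℝ (hg.dy.memLp_of_quadrant.toLp _) v := by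
  have hswap : ∀ F : ℝ × ℝ → ℝ, ∫ q : ℝ × ℝ, F q.swap = ∫ p, F p := fun F => integral_prod_swap F
  have htest : IsTestFunction (Prod.swap ⁻¹' offAxis)
      fun q : ℝ × ℝ => weight β ρ j q.swap * g q.swap * 1 := by
    simpa only [mul_one, Function.comp_def] using
      (hg.mono quadrant_subset_offAxis).weight_mul.comp_swap
  have hdx : dx (fun q : ℝ × ℝ => weight β ρ j q.swap * g q.swap * 1) =
      fun q => weight β ρ j q.swap * dy g q.swap := by
    simp only [mul_one]
    exact funext fun q => deriv_const_mul_field (weight β ρ j q.swap)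
  have hparts := H.vertical.integral_mul htest
    (integrable_weight_mul hg.memLp_of_quadrant k.2).swap
  simp only [hdx] at hparts
  rw [inner_toLp, inner_toLp, ← hswap, ← hswap fun p => weight β ρ j p * dy g p * v p]
  exact hparts (integrable_weight_mul hg.dy.memLp_of_quadrant v).swap

/-- The generator of the form on functions supported in the quadrant. It is `opLaplace` for `j = 0`
and `opA` for `j = 1`, `ρ = 0`. -/
def weightedOp (β ρ : ℝ) (j : ℕ) (f : ℝ × ℝ → ℝ) (p : ℝ × ℝ) : ℝ :=
  opA β ρ f p + β * (1 - j) / 2 * p.1 ^ (2 * β - 1) * dx f p -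
    ρ * β * j / 2 * p.1 ^ (β - 1) * dy f p

theorem weightedOp_zero : weightedOp β ρ 0 = opLaplace β ρ := by
  funext f p
  simp only [weightedOp, opLaplace, Nat.cast_zero]
  ring

theorem weightedOp_of_beta_eq_zero : weightedOp 0 ρ j = opA 0 ρ := by
  funext f p
  simp only [weightedOp]
  ring

theorem weightedOp_one_of_rho_eq_zero : weightedOp β 0 1 = opA β 0 := by
  funext f p
  simp only [weightedOp, Nat.cast_one]
  ring

theorem weightedOp_eq_div (hf : IsTestFunction quadrant f) :
    weightedOp β ρ j f = fun p => 1 / 2 * (adjX β j (fun q => q.1 ^ β * dx f q) p +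
      ρ * (adjX β j (dy f) p + dy (fun q => q.1 ^ β * dx f q) p) + dy (dy f) p) := by
  have hoff := hf.dx.mono quadrant_subset_offAxis
  have hdy : ∀ p, dy (fun q => q.1 ^ β * dx f q) p = p.1 ^ β * dx (dy f) p := fun p => by
    rw [dx_dy_comm hf]
    exact deriv_const_mul_field (p.1 ^ β)
  funext p
  rw [hdy, adjX, adjX, dx_fst_rpow_mul β hoff, weightedOp, opA]
  by_cases hp : p ∈ quadrant
  · have hpow : p.1 ^ (2 * β) = p.1 ^ β * p.1 ^ β := by rw [← Real.rpow_add hp.1, two_mul]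
    have hpow' : p.1 ^ (2 * β - 1) = p.1 ^ β * p.1 ^ (β - 1) := by
      rw [← Real.rpow_add hp.1, two_mul, add_sub_assoc]
    rw [hpow, hpow']
    ring
  · simp only [hf.dx.eq_zero hp, hf.dy.eq_zero hp, hf.dx.dx.eq_zero hp, hf.dy.dx.eq_zero hp,
      hf.dy.dy.eq_zero hp, mul_zero, add_zero, sub_zero]

theorem IsTestFunction.weightedOp (hf : IsTestFunction quadrant f) :
    IsTestFunction quadrant (weightedOp β ρ j f) := by
  have hX := hf.dx.fst_rpow_mul β
  rw [weightedOp_eq_div hf]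
  exact ((hX.adjX.add ((hf.dy.adjX.add hX.dy).const_mul ρ)).add hf.dy.dy).const_mul (1 / 2)

theorem toLp_weightedOp (hf : IsTestFunction quadrant f) :
    (hf.weightedOp (β := β) (j := j)).memLp_of_quadrant.toLp (weightedOp β ρ j f) =
      ((1 / 2 : ℝ) • ((hf.dx.fst_rpow_mul β).adjX.memLp_of_quadrant.toLp
          (adjX β j fun p => p.1 ^ β * dx f p) +
        ρ • (hf.dy.adjX.memLp_of_quadrant.toLp (adjX β j (dy f)) +
          (hf.dx.fst_rpow_mul β).dy.memLp_of_quadrant.toLp (dy fun p => p.1 ^ β * dx f p)) +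
        hf.dy.dy.memLp_of_quadrant.toLp (dy (dy f))) : WeightedL2 β ρ j) := by
  simp only [← MemLp.toLp_const_smul, ← MemLp.toLp_add]
  exact MemLp.toLp_congr _ _ (Eq.eventuallyEq (weightedOp_eq_div hf))

theorem hasGradient_toLp_of_quadrant (hρ : |ρ| < 1) (hf : IsTestFunction quadrant f) :
    HasGradient (β := β) (ρ := ρ) (j := j) (hf.memLp_of_quadrant.toLp f)
      ((hf.dx.fst_rpow_mul β).memLp_of_quadrant.toLp _, hf.dy.memLp_of_quadrant.toLp _) := by
  have heq := abs_fst_rpow_mul β hf.dx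
  convert hasGradient_toLp_of_offAxis hρ (hf.mono quadrant_subset_offAxis)
    (heq ▸ (hf.dx.fst_rpow_mul β).memLp_of_quadrant) using 3
  exact heq.symm

theorem HasGradient.form_toLp (hρ : |ρ| < 1) (H : HasGradient v k)
    (hf : IsTestFunction quadrant f) : form β ρ j (hf.memLp_of_quadrant.toLp f) v =
      -inner ℝ ((hf.weightedOp (β := β) (ρ := ρ) (j := j)).memLp_of_quadrant.toLp _) v := by
  rw [(hasGradient_toLp_of_quadrant hρ hf).form_eq H, energyForm_apply,
    H.inner_fst (hf.dx.fst_rpow_mul β), H.inner_fst hf.dy, H.inner_snd (hf.dx.fst_rpow_mul β),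
    H.inner_snd hf.dy, toLp_weightedOp hf]
  simp only [inner_add_left, real_inner_smul_left]
  ring

theorem generatorMatches_weightedOp (hρ : |ρ| < 1) :
    GeneratorMatches β ρ j (weightedOp β ρ j) := by
  intro f g hf hg
  obtain ⟨hmem, heq⟩ := generator_eq_of_dense (dense_formDomain (β := β) (j := j) hρ)
    (hasGradient_toLp_of_quadrant hρ hf).mem_formDomain fun v hv =>
      (exists_hasGradient hρ hv).elim fun k H => H.form_toLp hρ hf
  have hform := (hasGradient_toLp_of_quadrant (β := β) (j := j) hρ hg).form_toLp hρ hf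
  exact ⟨hf.memLp_of_quadrant, hg.memLp_of_quadrant, hf.weightedOp.memLp_of_quadrant, hmem, heq,
    by rw [heq], by rw [hform, neg_neg]⟩

end Generator

end TimeChangedSABR

end

open TimeChangedSABR in
theorem mainTheorem5_general (β ρ : ℝ) (j : ℕ) (hρ : |ρ| < 1) :
    (β * (1 - j) < 1 → IsDirichletForm (form β ρ j) (formDomain β ρ j)) ∧
    (β * (1 + j) < 1 → |β * (1 - j)| < 1 →
      (∀ f₁ f₂ : ℝ × ℝ → ℝ, IsTestFunction Set.univ f₁ → IsTestFunction Set.univ f₂ →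
        ∃ (h₁ : MemLp f₁ 2 (weightedMeasure β ρ j)) (h₂ : MemLp f₂ 2 (weightedMeasure β ρ j)),
          Integrable (fun p => coefForm β ρ p (dx f₁ p) (dy f₁ p) (dx f₂ p) (dy f₂ p))
            (weightedMeasure β ρ j) ∧
          form β ρ j (h₁.toLp f₁) (h₂.toLp f₂) =
            (1 / 2) * ∫ p, coefForm β ρ p (dx f₁ p) (dy f₁ p) (dx f₂ p) (dy f₂ p)
              ∂(weightedMeasure β ρ j)) ∧
      IsSymmetricForm (form β ρ j) (testDomain β ρ j) ∧
      IsClosable (form β ρ j) (testDomain β ρ j)) ∧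
    GeneratorMatches β ρ j (weightedOp β ρ j) :=
  ⟨isDirichletForm_formDomain hρ, fun hs hβ =>
    ⟨fun _ _ => exists_form_toLp_eq hρ hs (abs_lt.1 hβ).1,
      isSymmetricForm_testDomain hρ hs (abs_lt.1 hβ).1, isClosable_testDomain hρ hs hβ⟩,
    generatorMatches_weightedOp hρ⟩

open TimeChangedSABR in
theorem mainTheorem5 (β ρ : ℝ) (hβ₀ : 0 ≤ β) (hβ₁ : β ≤ 1) (hρ₀ : -1 < ρ) (hρ₁ : ρ < 1) :
    (∀ j : ℕ, (j = 0 ∧ β < 1) ∨ (j = 1 ∧ β < 1 / 2) →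
      -- on test functions the form is given by the classical partial derivatives
      (∀ f₁ f₂ : ℝ × ℝ → ℝ, IsTestFunction Set.univ f₁ → IsTestFunction Set.univ f₂ →
        ∃ (h₁ : MemLp f₁ 2 (weightedMeasure β ρ j)) (h₂ : MemLp f₂ 2 (weightedMeasure β ρ j)),
          Integrable (fun p => coefForm β ρ p (dx f₁ p) (dy f₁ p) (dx f₂ p) (dy f₂ p))
            (weightedMeasure β ρ j) ∧
          form β ρ j (h₁.toLp f₁) (h₂.toLp f₂) =
            (1 / 2) * ∫ p, coefForm β ρ p (dx f₁ p) (dy f₁ p) (dx f₂ p) (dy f₂ p)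
              ∂(weightedMeasure β ρ j)) ∧
      IsSymmetricForm (form β ρ j) (testDomain β ρ j) ∧
      IsClosable (form β ρ j) (testDomain β ρ j) ∧
      IsDirichletForm (form β ρ j) (formDomain β ρ j)) ∧
    GeneratorMatches β ρ 0 (opLaplace β ρ) ∧
    (β = 0 → GeneratorMatches β ρ 0 (opA β ρ)) ∧
    (ρ = 0 → GeneratorMatches β ρ 1 (opA β ρ)) := by
  have hρ : |ρ| < 1 := abs_lt.2 ⟨hρ₀, hρ₁⟩
  refine ⟨fun j hj => ?_, ?_, ?_, ?_⟩
  · obtain ⟨hs, hβ⟩ : β * (1 + j) < 1 ∧ |β * (1 - j)| < 1 := by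
      rcases hj with ⟨rfl, hβ⟩ | ⟨rfl, hβ⟩
      · exact ⟨by simpa using hβ, by simpa [abs_of_nonneg hβ₀] using hβ⟩
      · exact ⟨by norm_num; linarith, by norm_num⟩
    obtain ⟨hDirichlet, htest, -⟩ := mainTheorem5_general β ρ j hρ
    obtain ⟨hformula, hsymm, hclosable⟩ := htest hs hβ
    exact ⟨hformula, hsymm, hclosable, hDirichlet (abs_lt.1 hβ).2⟩
  · exact weightedOp_zero ▸ generatorMatches_weightedOp hρ
  · rintro rfl
    exact weightedOp_of_beta_eq_zero ▸ generatorMatches_weightedOp hρ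
  · rintro rfl
    exact weightedOp_one_of_rho_eq_zero ▸ generatorMatches_weightedOp hρ
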